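/- Let $\mathbb K$ be a field and let $q\in\mathbb K$ be non-zero and not a root of unity. Let $A=U_q^+(G_2)$ be the $\mathbb K$-algebra generated by $E_1,\dots,E_6$ subject to the relations \begin{align*} E_2E_1&=q^{-3}E_1E_2, & E_3E_1&=q^{-1}E_1E_3-(q+q^{-1}+q^{-3})E_2,\\ E_3E_2&=q^{-3}E_2E_3, & E_4E_1&=E_1E_4+(1-q^2)E_3^2,\\ E_4E_2&=q^{-3}E_2E_4-\tfrac{q^4-2q^2+1}{q^4+q^2+1}E_3^3, & E_4E_3&=q^{-3}E_3E_4,\\ E_5E_1&=qE_1E_5-(1+q^2)E_3, & E_5E_2&=E_2E_5+(1-q^2)E_3^2,\\ E_5E_3&=q^{-1}E_3E_5-(q+q^{-1}+q^{-3})E_4, & E_5E_4&=q^{-3}E_4E_5,\\ E_6E_1&=q^3E_1E_6-q^3E_5, & E_6E_2&=q^3E_2E_6+(q^4+q^2-1)E_4+(q^2-q^4)E_3E_5,\\ E_6E_3&=E_3E_6+(1-q^2)E_5^2, & E_6E_4&=q^{-3}E_4E_6-\tfrac{q^4-2q^2+1}{q^4+q^2+1}E_5^3,\\ E_6E_5&=q^{-3}E_5E_6.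 && \end{align*} Put \begin{align*} \Omega_1&=E_1E_3E_5+aE_1E_4+aE_2E_5+a'E_3^2,\\ \Omega_2&=E_2E_4E_6+bE_2E_5^3+bE_3^3E_6+b'E_3^2E_5^2+c'E_3E_4E_5+d'E_4^2, \end{align*} where $$a=\frac{q^2+1+q^{-2}}{q^{-2}-1},\quad a'=\frac{q^6}{q^2-1},\quad b=-\frac{q^7-2q^5+q^3}{(q^4+q^2+1)(1-q^{-6})},\quad b'=\frac{q^{13}-q^{11}}{(q^4+q^2+1)^2},\quad c'=-\frac{q^9}{q^4+q^2+1},\quad d'=\frac{q^{12}}{q^6-1}.$$ (1) Let $(\alpha,\beta)\in\mathbb K^2\setminus\{(0,0)\}$, let $A_{\alpha,\beta}=A/\langle\Omega_1-\alpha,\Omega_2-\beta\rangle$ (quotient by the two-sided ideal), and let $e_i$ be the image of $E_i$ in $A_{\alpha,\beta}$. Then the monomials $e_1^{i}e_2^{j}e_3^{\epsilon_1}e_4^{\epsilon_2}e_5^{k}e_6^{l}$, with $i,j,k,l\in\mathbb N$ and $\epsilon_1,\epsilon_2\in\{0,1\}$, form a $\mathbb K$-basis of $A_{\alpha,\beta}$.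 (2) Let $\beta\in\mathbb K$, let $A_\beta=A/\langle\Omega_2-\beta\rangle$, and let $\widehat e_i$ be the image of $E_i$ in $A_\beta$. Then the monomials $\widehat e_1^{\,i}\widehat e_2^{\,j}\widehat e_3^{\,k}\widehat e_4^{\,\xi}\widehat e_5^{\,l}\widehat e_6^{\,m}$, with $i,j,k,l,m\in\mathbb N$ and $\xi\in\{0,1\}$, form a $\mathbb K$-basis of $A_\beta$. -/

import Mathlib

namespace QuantumG2

/-- Names of the six root-vector generators. -/
inductive Gen : Type
  | E1 | E2 | E3 | E4 | E5 | E6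

/-- The free generator with the given name. -/
abbrev gen (K : Type*) [Field K] (i : Gen) : FreeAlgebra K Gen := FreeAlgebra.ι K i

open Gen in
/-- The fifteen defining relations of `U_q^+(G_2)` in the root vectors
`E1 = E_α`, `E2 = E_{3α+β}`, `E3 = E_{2α+β}`, `E4 = E_{3α+2β}`, `E5 = E_{α+β}`, `E6 = E_β`. -/
inductive Rel (K : Type*) [Field K] (q : K) : FreeAlgebra K Gen → FreeAlgebra K Gen → Prop
  | r21 : Rel K q (gen K E2 * gen K E1) (q⁻¹ ^ 3 • (gen K E1 * gen K E2))
  | r31 : Rel K q (gen K E3 * gen K E1)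
      (q⁻¹ • (gen K E1 * gen K E3) - (q + q⁻¹ + q⁻¹ ^ 3) • gen K E2)
  | r32 : Rel K q (gen K E3 * gen K E2) (q⁻¹ ^ 3 • (gen K E2 * gen K E3))
  | r41 : Rel K q (gen K E4 * gen K E1)
      (gen K E1 * gen K E4 + (1 - q ^ 2) • gen K E3 ^ 2)
  | r42 : Rel K q (gen K E4 * gen K E2)
      (q⁻¹ ^ 3 • (gen K E2 * gen K E4)
        - ((q ^ 4 - 2 * q ^ 2 + 1) / (q ^ 4 + q ^ 2 + 1)) • gen K E3 ^ 3)
  | r43 : Rel K q (gen K E4 * gen K E3) (q⁻¹ ^ 3 • (gen K E3 * gen K E4))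
  | r51 : Rel K q (gen K E5 * gen K E1)
      (q • (gen K E1 * gen K E5) - (1 + q ^ 2) • gen K E3)
  | r52 : Rel K q (gen K E5 * gen K E2)
      (gen K E2 * gen K E5 + (1 - q ^ 2) • gen K E3 ^ 2)
  | r53 : Rel K q (gen K E5 * gen K E3)
      (q⁻¹ • (gen K E3 * gen K E5) - (q + q⁻¹ + q⁻¹ ^ 3) • gen K E4)
  | r54 : Rel K q (gen K E5 * gen K E4) (q⁻¹ ^ 3 • (gen K E4 * gen K E5))
  | r61 : Rel K q (gen K E6 * gen K E1)
      (q ^ 3 • (gen K E1 * gen K E6) - q ^ 3 • gen K E5)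
  | r62 : Rel K q (gen K E6 * gen K E2)
      (q ^ 3 • (gen K E2 * gen K E6) + (q ^ 4 + q ^ 2 - 1) • gen K E4
        + (q ^ 2 - q ^ 4) • (gen K E3 * gen K E5))
  | r63 : Rel K q (gen K E6 * gen K E3)
      (gen K E3 * gen K E6 + (1 - q ^ 2) • gen K E5 ^ 2)
  | r64 : Rel K q (gen K E6 * gen K E4)
      (q⁻¹ ^ 3 • (gen K E4 * gen K E6)
        - ((q ^ 4 - 2 * q ^ 2 + 1) / (q ^ 4 + q ^ 2 + 1)) • gen K E5 ^ 3)
  | r65 : Rel K q (gen K E6 * gen K E5) (q⁻¹ ^ 3 • (gen K E5 * gen K E6))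

/-- The algebra `A = U_q^+(G_2)`. -/
abbrev UqG2 (K : Type*) [Field K] (q : K) : Type _ := RingQuot (Rel K q)

/-- The generators `E_i` of `A`. -/
noncomputable def E {K : Type*} [Field K] (q : K) (i : Gen) : UqG2 K q :=
  RingQuot.mkAlgHom K (Rel K q) (gen K i)

/-- The scalar `a`. -/
noncomputable def cA {K : Type*} [Field K] (q : K) : K :=
  (q ^ 2 + 1 + q⁻¹ ^ 2) / (q⁻¹ ^ 2 - 1)

/-- The scalar `a'`. -/
noncomputable def cA' {K : Type*} [Field K] (q : K) : K := q ^ 6 / (q ^ 2 - 1)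

/-- The scalar `b`. -/
noncomputable def cB {K : Type*} [Field K] (q : K) : K :=
  -((q ^ 7 - 2 * q ^ 5 + q ^ 3) / ((q ^ 4 + q ^ 2 + 1) * (1 - q⁻¹ ^ 6)))

/-- The scalar `b'`. -/
noncomputable def cB' {K : Type*} [Field K] (q : K) : K :=
  (q ^ 13 - q ^ 11) / (q ^ 4 + q ^ 2 + 1) ^ 2

/-- The scalar `c'`. -/
noncomputable def cC' {K : Type*} [Field K] (q : K) : K := -(q ^ 9 / (q ^ 4 + q ^ 2 + 1))

/-- The scalar `d'`. -/
noncomputable def cD' {K : Type*} [Field K] (q : K) : K := q ^ 12 / (q ^ 6 - 1)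

open Gen in
/-- The central element `Ω₁` of `A`. -/
noncomputable def Omega1 {K : Type*} [Field K] (q : K) : UqG2 K q :=
  E q E1 * E q E3 * E q E5 + cA q • (E q E1 * E q E4) + cA q • (E q E2 * E q E5)
    + cA' q • E q E3 ^ 2

open Gen in
/-- The central element `Ω₂` of `A`. -/
noncomputable def Omega2 {K : Type*} [Field K] (q : K) : UqG2 K q :=
  E q E2 * E q E4 * E q E6 + cB q • (E q E2 * E q E5 ^ 3) + cB q • (E q E3 ^ 3 * E q E6)
    + cB' q • (E q E3 ^ 2 * E q E5 ^ 2) + cC' q • (E q E3 * E q E4 * E q E5)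
    + cD' q • E q E4 ^ 2

/-- The two-sided ideal `⟨Ω₂ - β⟩` of `A`. -/
noncomputable abbrev idealB {K : Type*} [Field K] (q β : K) : TwoSidedIdeal (UqG2 K q) :=
  TwoSidedIdeal.span {Omega2 q - algebraMap K (UqG2 K q) β}

/-- The algebra `A_β = A / ⟨Ω₂ - β⟩`. -/
abbrev AB {K : Type*} [Field K] (q β : K) : Type _ := (idealB q β).ringCon.Quotient

/-- The image `ê_i` of `E_i` in `A_β`. -/
noncomputable def eB {K : Type*} [Field K] (q β : K) (i : Gen) : AB q β :=
  (idealB q β).ringCon.mk' (E q i)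

/-- The two-sided ideal `⟨Ω₁ - α, Ω₂ - β⟩` of `A`. -/
noncomputable abbrev idealAB {K : Type*} [Field K] (q α β : K) : TwoSidedIdeal (UqG2 K q) :=
  TwoSidedIdeal.span
    {Omega1 q - algebraMap K (UqG2 K q) α, Omega2 q - algebraMap K (UqG2 K q) β}

/-- The algebra `A_{α,β} = A / ⟨Ω₁ - α, Ω₂ - β⟩`. -/
abbrev AAB {K : Type*} [Field K] (q α β : K) : Type _ := (idealAB q α β).ringCon.Quotient

/-- The image `e_i` of `E_i` in `A_{α,β}`. -/
noncomputable def e {K : Type*} [Field K] (q α β : K) (i : Gen) : AAB q α β :=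
  (idealAB q α β).ringCon.mk' (E q i)

end QuantumG2

-- The algebra is an iterated Ore extension, so the ordered monomials in `E1`, ..., `E6` form a
-- basis (`exists_basis_orderedMonomial`). To adjoin a generator to an algebra R one needs a skew
-- derivation (σ, δ), which amounts to an algebra map r ↦ [[σ r, δ r], [0, r]] into 2×2 matrices
-- over R. Such a map exists as soon as the matrices assigned to the earlier generators satisfy
-- their relations, a finite computation (`resolvesAt_two` to `resolvesAt_five`). The enlarged
-- algebra then acts on finitely supported sequences in R, and this action proves independence.
--
-- Both Ω₁ and Ω₂ are central. Give `E3` weight 3, `E4` weight 5 and the other generators weight 0.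
-- The heaviest term of Ω₁ is a'E₃² (6, against 5 for E₁E₄), that of Ω₂ is d'E₄² (10, against 9 for
-- E₃³E₆). These comparisons ask for 3/2 < w₄/w₃ < 2, and (3, 5) is the smallest integral solution.
-- A central factor may be inserted anywhere in an ordered monomial; at a suitable place one sees
-- that multiplication by Ω₁ or Ω₂ raises the exponent of `E3` or `E4` by two, up to a nonzero
-- scalar and lower weight (`Omega1_mul_sixMonomial`, `Omega2_mul_sixMonomial`).
--
-- By triangularity (`exists_basis_of_triangular`) the products of powers of Ω₁ and Ω₂ with the
-- monomials of exponent at most 1 in `E3` and `E4` form another basis: the algebra is free over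
-- K[Ω₁, Ω₂]. Specialising Ω₁ to α and Ω₂ to β leaves the monomials of (1)
-- (`exists_basis_quotient_of_central`). Using Ω₂ alone gives (2).

universe u

namespace QuantumG2

/-! ### The action of an Ore extension on sequences of coefficients. -/

section OreAction

variable {K : Type u} [Field K] {R S : Type u} [Ring R] [Algebra K R] [Ring S] [Algebra K S]

/-- The action of the indeterminate of the Ore extension `R[X; σ, δ]` on itself by left
multiplication, where `∑ rₙ Xⁿ` is stored as the finitely supported function `n ↦ rₙ`. -/
noncomputable def oreX (σ δ : R →ₗ[K] R) : Module.End K (ℕ →₀ R) :=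
  Finsupp.lsum K fun n => Finsupp.lsingle (n + 1) ∘ₗ σ + Finsupp.lsingle n ∘ₗ δ

@[simp]
theorem oreX_single (σ δ : R →ₗ[K] R) (n : ℕ) (r : R) :
    oreX σ δ (Finsupp.single n r) = Finsupp.single (n + 1) (σ r) + Finsupp.single n (δ r) := by
  simp [oreX]

/-- This is the Ore relation X r = σ(r) X + δ(r), read in the endomorphism ring. -/
theorem oreX_smul (σ δ : R →ₗ[K] R) (hσ : ∀ a b, σ (a * b) = σ a * σ b)
    (hδ : ∀ a b, δ (a * b) = σ a * δ b + δ a * b) (r : R) (g : ℕ →₀ R) :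
    oreX σ δ (r • g) = σ r • oreX σ δ g + δ r • g := by
  induction g using Finsupp.induction_linear with
  | zero => simp
  | add f g hf hg => simp only [smul_add, map_add, hf, hg]; abel
  | single n a =>
    simp only [Finsupp.smul_single, smul_eq_mul, oreX_single, smul_add, hσ, hδ,
      Finsupp.single_add, add_assoc]

theorem oreX_pow_single (σ δ : R →ₗ[K] R) (hσ : σ 1 = 1) (hδ : δ 1 = 0) (n : ℕ) :
    (oreX σ δ ^ n) (Finsupp.single 0 1) = Finsupp.single n 1 := by
  induction n with
  | zero => simp
  | succ n ih => rw [pow_succ', Module.End.mul_apply, ih]; simp [hσ, hδ]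

/-- The map `∑ rₙ Xⁿ ↦ ∑ f rₙ * xⁿ`. -/
noncomputable def oreEval (f : R →ₐ[K] S) (x : S) : (ℕ →₀ R) →ₗ[K] S :=
  Finsupp.lsum K fun n => LinearMap.mulRight K (x ^ n) ∘ₗ f.toLinearMap

@[simp]
theorem oreEval_single (f : R →ₐ[K] S) (x : S) (n : ℕ) (r : R) :
    oreEval f x (Finsupp.single n r) = f r * x ^ n := by
  simp [oreEval]

theorem oreEval_smul (f : R →ₐ[K] S) (x : S) (r : R) (g : ℕ →₀ R) :
    oreEval f x (r • g) = f r * oreEval f x g := by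
  induction g using Finsupp.induction_linear with
  | zero => simp
  | add f g hf hg => simp only [smul_add, map_add, hf, hg, mul_add]
  | single n a =>
    simp only [Finsupp.smul_single, smul_eq_mul, oreEval_single, map_mul, mul_assoc]

theorem oreEval_oreX (σ δ : R →ₗ[K] R) (f : R →ₐ[K] S) (x : S)
    (hx : ∀ r, x * f r = f (σ r) * x + f (δ r)) (g : ℕ →₀ R) :
    oreEval f x (oreX σ δ g) = x * oreEval f x g := by
  induction g using Finsupp.induction_linear with
  | zero => simp
  | add f g hf hg => simp only [map_add, hf, hg, mul_add]
  | single n a => simp [← mul_assoc, hx, add_mul, pow_succ']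

/-- Injectivity: letting an element act on the sequence 1·X⁰ recovers its coefficients.
Surjectivity: the range contains 1 and is stable under left multiplication by generators, hence by
all of S. -/
theorem oreEval_bijective (σ δ : R →ₗ[K] R) (hσ1 : σ 1 = 1) (hδ1 : δ 1 = 0)
    (f : R →ₐ[K] S) (x : S) (hx : ∀ r, x * f r = f (σ r) * x + f (δ r))
    (hgen : Algebra.adjoin K (Set.range f ∪ {x}) = ⊤)
    (ψ : S →ₐ[K] Module.End K (ℕ →₀ R)) (hψf : ∀ r g, ψ (f r) g = r • g)
    (hψx : ψ x = oreX σ δ) : Function.Bijective (oreEval f x) := by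
  constructor
  · have key : ∀ g, ψ (oreEval f x g) (Finsupp.single 0 1) = g := by
      intro g
      induction g using Finsupp.induction_linear with
      | zero => simp
      | add f g hf hg => simp only [map_add, LinearMap.add_apply, hf, hg]
      | single n a =>
        rw [oreEval_single, map_mul, map_pow, Module.End.mul_apply, hψx,
          oreX_pow_single σ δ hσ1 hδ1, hψf]
        simp [Finsupp.smul_single]
    exact Function.LeftInverse.injective (g := fun s => ψ s (Finsupp.single 0 1)) key
  · have key : ∀ s : S, ∀ t ∈ LinearMap.range (oreEval f x),
        s * t ∈ LinearMap.range (oreEval f x) := by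
      intro s
      have hs : s ∈ Algebra.adjoin K (Set.range f ∪ {x}) := hgen ▸ Algebra.mem_top
      induction hs using Algebra.adjoin_induction with
      | mem s hs =>
        rintro _ ⟨g, rfl⟩
        rcases hs with ⟨r, rfl⟩ | rfl
        · exact ⟨r • g, oreEval_smul f x r g⟩
        · exact ⟨oreX σ δ g, oreEval_oreX σ δ f _ hx g⟩
      | algebraMap k =>
        intro t ht
        rw [← Algebra.smul_def]
        exact Submodule.smul_mem _ _ ht
      | add a b _ _ ha hb =>
        intro t ht
        rw [add_mul]
        exact Submodule.add_mem _ (ha t ht) (hb t ht)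
      | mul a b _ _ ha hb =>
        intro t ht
        rw [mul_assoc]
        exact ha _ (hb t ht)
    intro s
    obtain ⟨g, hg⟩ := key s 1 ⟨Finsupp.single 0 1, by simp⟩
    exact ⟨g, by simpa using hg⟩

end OreAction

/-! ### Iterated Ore extensions by generators and relations, and their ordered monomial bases. -/

section OrePresentation

variable {K : Type u} [Field K] (c : ℕ → ℕ → K) (d : ℕ → ℕ → FreeAlgebra K ℕ)

/-- The first `n` elements of `y` satisfy `y j * y i = c j i • (y i * y j) + d j i` for `i < j`. -/
def Straightens (n : ℕ) {T : Type u} [Ring T] [Algebra K T] (y : ℕ → T) : Prop :=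
  ∀ i j, i < j → j < n → y j * y i = c j i • (y i * y j) + FreeAlgebra.lift K y (d j i)

/-- The tail `d j i` involves only the generators with index less than `j`. -/
def IsLocal : Prop :=
  ∀ (T : Type u) [Ring T] [Algebra K T] (y z : ℕ → T) (i j : ℕ), i < j →
    (∀ k < j, y k = z k) → FreeAlgebra.lift K y (d j i) = FreeAlgebra.lift K z (d j i)

/-- The matrices which encode the skew derivation attached to the `n`-th generator. -/
noncomputable def skewMatrix (n : ℕ) {T : Type u} [Ring T] [Algebra K T] (y : ℕ → T) (i : ℕ) :
    Matrix (Fin 2) (Fin 2) T :=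
  if i < n then !![c n i • y i, FreeAlgebra.lift K y (d n i); 0, y i] else 0

/-- All overlap ambiguities with largest generator of index `n` are resolvable. -/
def ResolvesAt (n : ℕ) : Prop :=
  ∀ (T : Type u) [Ring T] [Algebra K T] (y : ℕ → T),
    Straightens c d n y → Straightens c d n (skewMatrix c d n y)

/-- Defining relations of the algebra on the first `n` generators. -/
inductive OreRel (n : ℕ) : FreeAlgebra K ℕ → FreeAlgebra K ℕ → Prop
  | straighten (i j : ℕ) : i < j → j < n →
      OreRel n (FreeAlgebra.ι K j * FreeAlgebra.ι K i)
        (c j i • (FreeAlgebra.ι K i * FreeAlgebra.ι K j) + d j i)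
  | kill (j : ℕ) : n ≤ j → OreRel n (FreeAlgebra.ι K j) 0

/-- The algebra on the first `n` generators. -/
abbrev OreAlg (n : ℕ) : Type u := RingQuot (OreRel c d n)

/-- The generators of `OreAlg c d n`. -/
noncomputable def oreGen (n i : ℕ) : OreAlg c d n :=
  RingQuot.mkAlgHom K (OreRel c d n) (FreeAlgebra.ι K i)

/-- Exponents of ordered monomials in `n` generators. -/
def Exps : ℕ → Type
  | 0 => Unit
  | n + 1 => Exps n × ℕ

/-- Splitting off the last exponent. -/
def sigmaExpsEquiv (n : ℕ) : (Σ _ : ℕ, Exps n) ≃ Exps (n + 1) where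
  toFun s := (s.2, s.1)
  invFun s := ⟨s.2, s.1⟩
  left_inv _ := rfl
  right_inv _ := rfl

/-- Ordered monomials in the first `n` elements of `y`. -/
def orderedMonomial {T : Type u} [Ring T] (y : ℕ → T) : (n : ℕ) → Exps n → T
  | 0, _ => 1
  | n + 1, s => orderedMonomial y n s.1 * y n ^ s.2

theorem orderedMonomial_congr {T : Type u} [Ring T] (y z : ℕ → T) (n : ℕ) (h : ∀ k < n, y k = z k)
    (s : Exps n) : orderedMonomial y n s = orderedMonomial z n s := by
  induction n with
  | zero => rfl
  | succ n ih =>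
    simp only [orderedMonomial]
    rw [ih (fun k hk => h k (by omega)), h n (by omega)]

theorem map_orderedMonomial {T T' : Type u} [Ring T] [Ring T'] [Algebra K T] [Algebra K T']
    (f : T →ₐ[K] T') (y : ℕ → T) (n : ℕ) (s : Exps n) :
    f (orderedMonomial y n s) = orderedMonomial (fun i => f (y i)) n s := by
  induction n with
  | zero => exact map_one f
  | succ n ih => simp only [orderedMonomial, map_mul, map_pow, ih]

variable {c d}

theorem mk_eq_lift_oreGen (n : ℕ) (w : FreeAlgebra K ℕ) :
    RingQuot.mkAlgHom K (OreRel c d n) w = FreeAlgebra.lift K (oreGen c d n) w := by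
  congr 1
  ext i
  simp [oreGen]

theorem straightens_oreGen (n : ℕ) : Straightens c d n (oreGen c d n) := by
  intro i j hij hj
  have := RingQuot.mkAlgHom_rel K (OreRel.straighten (c := c) (d := d) i j hij hj)
  simpa [mk_eq_lift_oreGen] using this

theorem oreGen_eq_zero {n j : ℕ} (h : n ≤ j) : oreGen c d n j = 0 := by
  have := RingQuot.mkAlgHom_rel K (OreRel.kill (c := c) (d := d) j h)
  simpa [oreGen] using this

theorem OreAlg.induction (n : ℕ) {p : OreAlg c d n → Prop} (hgen : ∀ i, p (oreGen c d n i))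
    (halg : ∀ k, p (algebraMap K _ k)) (hadd : ∀ a b, p a → p b → p (a + b))
    (hmul : ∀ a b, p a → p b → p (a * b)) (r : OreAlg c d n) : p r := by
  obtain ⟨w, rfl⟩ := RingQuot.mkAlgHom_surjective K (OreRel c d n) r
  induction w using FreeAlgebra.induction with
  | grade0 k => rw [AlgHom.commutes]; exact halg k
  | grade1 i => exact hgen i
  | mul a b ha hb => rw [map_mul]; exact hmul _ _ ha hb
  | add a b ha hb => rw [map_add]; exact hadd _ _ ha hb

theorem exists_oreLift (n : ℕ) {T : Type u} [Ring T] [Algebra K T] (y : ℕ → T)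
    (hy : Straightens c d n y) (h0 : ∀ j, n ≤ j → y j = 0) :
    ∃ f : OreAlg c d n →ₐ[K] T, ∀ i, f (oreGen c d n i) = y i := by
  refine ⟨RingQuot.liftAlgHom K ⟨FreeAlgebra.lift K y, ?_⟩, fun i => ?_⟩
  · rintro _ _ (⟨i, j, hij, hj⟩ | ⟨j, hj⟩)
    · simpa using hy i j hij hj
    · simpa using h0 j hj
  · simp [oreGen]

theorem Straightens.congr (hd : IsLocal d) {n : ℕ} {T : Type u} [Ring T] [Algebra K T]
    {y z : ℕ → T} (hy : Straightens c d n y) (h : ∀ k < n, y k = z k) : Straightens c d n z := by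
  intro i j hij hj
  rw [← h i (by omega), ← h j hj, hy i j hij hj,
    hd T y z i j hij fun k hk => h k (by omega)]

theorem Straightens.mono {m n : ℕ} (hmn : m ≤ n) {T : Type u} [Ring T] [Algebra K T]
    {y : ℕ → T} (hy : Straightens c d n y) : Straightens c d m y :=
  fun i j hij hj => hy i j hij (hj.trans_le hmn)

theorem Straightens.map {n : ℕ} {T T' : Type u} [Ring T] [Algebra K T] [Ring T'] [Algebra K T']
    {y : ℕ → T} (hy : Straightens c d n y) (f : T →ₐ[K] T') :
    Straightens c d n fun i => f (y i) := by
  intro i j hij hj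
  have hl : (FreeAlgebra.lift K fun i => f (y i)) = f.comp (FreeAlgebra.lift K y) := by
    ext i; simp
  rw [← map_mul, hy i j hij hj, hl]
  simp

/-- The skew derivation on `OreAlg c d n` by which the next generator acts. -/
theorem exists_skewDerivation (n : ℕ) (hres : ResolvesAt c d n) :
    ∃ σ δ : OreAlg c d n →ₗ[K] OreAlg c d n, σ 1 = 1 ∧ δ 1 = 0 ∧
      (∀ a b, σ (a * b) = σ a * σ b) ∧ (∀ a b, δ (a * b) = σ a * δ b + δ a * b) ∧
      ∀ i < n, σ (oreGen c d n i) = c n i • oreGen c d n i ∧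
        δ (oreGen c d n i) = FreeAlgebra.lift K (oreGen c d n) (d n i) := by
  -- `D r` will be [[σ r, δ r], [0, r]]; once the lower row is known, multiplicativity of `D` is the
  -- multiplicativity of σ together with the twisted Leibniz rule.
  obtain ⟨D, hD⟩ := exists_oreLift n (skewMatrix c d n (oreGen c d n))
    (hres _ _ (straightens_oreGen n)) (fun j hj => by simp [skewMatrix, not_lt.mpr hj])
  have low : ∀ r, D r 1 0 = 0 ∧ D r 1 1 = r := by
    intro r
    induction r using OreAlg.induction with
    | hgen i =>
      rw [hD]
      by_cases hi : i < n
      · simp [skewMatrix, hi]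
      · simp [skewMatrix, hi, oreGen_eq_zero (not_lt.mp hi)]
    | halg k => simp [Matrix.algebraMap_matrix_apply]
    | hadd a b ha hb => simp [ha, hb]
    | hmul a b ha hb => simp [Matrix.mul_apply, Fin.sum_univ_two, ha, hb]
  refine ⟨Matrix.entryLinearMap K _ 0 0 ∘ₗ D.toLinearMap,
    Matrix.entryLinearMap K _ 0 1 ∘ₗ D.toLinearMap, ?_, ?_, ?_, ?_, ?_⟩
  · simp
  · simp
  · intro a b
    simp [Matrix.mul_apply, Fin.sum_univ_two, low]
  · intro a b
    simp [Matrix.mul_apply, Fin.sum_univ_two, low]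
  · intro i hi
    simp [hD, skewMatrix, hi]

/-- The action of `OreAlg c d (n + 1)` on the Ore extension of an algebra in which the
relations of the first `n` generators hold. -/
theorem exists_oreLift_end (hd : IsLocal d) (n : ℕ) {R : Type u} [Ring R] [Algebra K R]
    (σ δ : R →ₗ[K] R) (hσ : ∀ a b, σ (a * b) = σ a * σ b)
    (hδ : ∀ a b, δ (a * b) = σ a * δ b + δ a * b) (x : ℕ → R) (hx : Straightens c d n x)
    (hgen : ∀ i < n, σ (x i) = c n i • x i ∧ δ (x i) = FreeAlgebra.lift K x (d n i)) :
    ∃ ψ : OreAlg c d (n + 1) →ₐ[K] Module.End K (ℕ →₀ R),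
      (∀ i < n, ∀ g, ψ (oreGen c d (n + 1) i) g = x i • g) ∧
      ψ (oreGen c d (n + 1) n) = oreX σ δ := by
  let L : R →ₐ[K] Module.End K (ℕ →₀ R) := Algebra.lsmul K K _
  have hXL : ∀ r, oreX σ δ * L r = L (σ r) * oreX σ δ + L (δ r) := fun r =>
    LinearMap.ext fun g => oreX_smul σ δ hσ hδ r g
  let z : ℕ → Module.End K (ℕ →₀ R) := fun i =>
    if i < n then L (x i) else if i = n then oreX σ δ else 0
  have hz : ∀ i < n, L (x i) = z i := fun i hi => (if_pos hi).symm
  have hzn : z n = oreX σ δ := by simp [z]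
  have hzS : Straightens c d (n + 1) z := by
    intro i j hij hj
    -- Relations among earlier generators hold because `L` is an algebra map; those involving the
    -- new generator are instances of `hXL`.
    rcases Nat.lt_succ_iff_lt_or_eq.mp hj with hj | rfl
    · exact (hx.map L).congr hd hz i j hij hj
    · have hl : (FreeAlgebra.lift K fun i => L (x i)) = L.comp (FreeAlgebra.lift K x) := by
        ext i : 2; simp
      rw [← hd _ _ z i j hij hz, hl, ← hz i hij, hzn, hXL, (hgen i hij).1, (hgen i hij).2]
      simp
  obtain ⟨ψ, hψ⟩ := exists_oreLift (n + 1) z hzS (fun j hj => by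
    simp [z, show ¬ j < n by omega, show j ≠ n by omega])
  exact ⟨ψ, fun i hi g => by rw [hψ, ← hz i hi]; rfl, (hψ n).trans hzn⟩

theorem oreEval_step (hd : IsLocal d) (n : ℕ) (hres : ResolvesAt c d n) :
    ∃ f : OreAlg c d n →ₐ[K] OreAlg c d (n + 1),
      (∀ i < n, f (oreGen c d n i) = oreGen c d (n + 1) i) ∧
      Function.Bijective (oreEval f (oreGen c d (n + 1) n)) := by
  obtain ⟨σ, δ, hσ1, hδ1, hσ, hδ, hgen⟩ := exists_skewDerivation n hres
  have hS := straightens_oreGen (c := c) (d := d) (n + 1)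
  have ite_eq : ∀ k < n, oreGen c d (n + 1) k = if k < n then oreGen c d (n + 1) k else 0 :=
    fun k hk => (if_pos hk).symm
  obtain ⟨f, hf⟩ := exists_oreLift n (fun i => if i < n then oreGen c d (n + 1) i else 0)
    ((hS.mono n.le_succ).congr hd ite_eq) (fun j hj => if_neg (not_lt.mpr hj))
  have hf' : ∀ i < n, f (oreGen c d n i) = oreGen c d (n + 1) i := fun i hi => by
    rw [hf, if_pos hi]
  have hlift : ∀ i < n, f (FreeAlgebra.lift K (oreGen c d n) (d n i)) =
      FreeAlgebra.lift K (oreGen c d (n + 1)) (d n i) := by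
    intro i hi
    rw [← hd _ (fun i => f (oreGen c d n i)) _ i n hi hf']
    have : (FreeAlgebra.lift K fun i => f (oreGen c d n i)) =
      f.comp (FreeAlgebra.lift K (oreGen c d n)) := by ext i; simp
    rw [this]; rfl
  obtain ⟨ψ, hψ, hψn⟩ := exists_oreLift_end hd n σ δ hσ hδ (oreGen c d n)
    (straightens_oreGen n) hgen
  refine ⟨f, hf', oreEval_bijective σ δ hσ1 hδ1 f _ ?_ ?_ ψ ?_ hψn⟩
  · intro r
    induction r using OreAlg.induction with
    | hgen i =>
      by_cases hi : i < n
      · rw [hf' i hi, hS i n hi n.lt_succ_self, (hgen i hi).1, (hgen i hi).2, hlift i hi,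
          map_smul, hf' i hi, smul_mul_assoc]
      · simp [oreGen_eq_zero (not_lt.mp hi)]
    | halg k =>
      simp [Algebra.algebraMap_eq_smul_one, hσ1, hδ1]
    | hadd a b ha hb => simp only [map_add, mul_add, add_mul, ha, hb]; abel
    | hmul a b ha hb =>
      rw [map_mul, ← mul_assoc, ha, add_mul, mul_assoc, hb, hσ, hδ]
      simp only [map_mul, map_add, mul_add, mul_assoc, add_assoc]
  · refine top_le_iff.mp fun r _ => ?_
    induction r using OreAlg.induction with
    | hgen i =>
      rcases lt_trichotomy i n with hi | rfl | hi
      · exact Algebra.subset_adjoin (Or.inl ⟨_, hf' i hi⟩)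
      · exact Algebra.subset_adjoin (Or.inr rfl)
      · rw [oreGen_eq_zero hi]; exact Subalgebra.zero_mem _
    | halg k => exact Subalgebra.algebraMap_mem _ k
    | hadd a b ha hb => exact Subalgebra.add_mem _ (ha trivial) (hb trivial)
    | hmul a b ha hb => exact Subalgebra.mul_mem _ (ha trivial) (hb trivial)
  · intro r g
    induction r using OreAlg.induction generalizing g with
    | hgen i =>
      by_cases hi : i < n
      · rw [hf' i hi, hψ i hi]
      · simp [oreGen_eq_zero (not_lt.mp hi)]
    | halg k => simp [Algebra.algebraMap_eq_smul_one]
    | hadd a b ha hb => simp only [map_add, LinearMap.add_apply, ha, hb, add_smul]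
    | hmul a b ha hb => simp only [map_mul, Module.End.mul_apply, ha, hb, mul_smul]

/-- Ordered monomials form a basis if all overlap ambiguities are resolvable. -/
theorem exists_basis_orderedMonomial (hd : IsLocal d) (n : ℕ) (hres : ∀ m < n, ResolvesAt c d m) :
    ∃ B : Module.Basis (Exps n) K (OreAlg c d n),
      ∀ s, B s = orderedMonomial (oreGen c d n) n s := by
  induction n with
  | zero =>
    have hsurj : Function.Surjective (algebraMap K (OreAlg c d 0)) := by
      intro r
      induction r using OreAlg.induction with
      | hgen i => exact ⟨0, by rw [map_zero, oreGen_eq_zero (Nat.zero_le i)]⟩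
      | halg k => exact ⟨k, rfl⟩
      | hadd a b ha hb =>
        obtain ⟨⟨a, rfl⟩, ⟨b, rfl⟩⟩ := And.intro ha hb
        exact ⟨a + b, map_add _ _ _⟩
      | hmul a b ha hb =>
        obtain ⟨⟨a, rfl⟩, ⟨b, rfl⟩⟩ := And.intro ha hb
        exact ⟨a * b, map_mul _ _ _⟩
    -- With no generators the algebra is K itself; this augmentation shows that the scalars embed.
    obtain ⟨f, -⟩ := exists_oreLift (c := c) (d := d) 0 (fun _ => (0 : K))
      (fun i j _ hj => absurd hj (Nat.not_lt_zero j)) (fun _ _ => rfl)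
    have hinj : Function.Injective (algebraMap K (OreAlg c d 0)) :=
      Function.LeftInverse.injective (g := f) fun k => f.commutes k
    let e : K ≃ₗ[K] OreAlg c d 0 :=
      LinearEquiv.ofBijective (Algebra.linearMap K _) ⟨hinj, hsurj⟩
    have : Unique (Exps 0) := inferInstanceAs (Unique Unit)
    refine ⟨(Module.Basis.singleton (Exps 0) K).map e, fun s => ?_⟩
    rw [Module.Basis.map_apply, Module.Basis.singleton_apply]
    exact map_one (algebraMap K (OreAlg c d 0))
  | succ n ih =>
    obtain ⟨B, hB⟩ := ih fun m hm => hres m (by omega)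
    obtain ⟨f, hf, hbij⟩ := oreEval_step hd n (hres n n.lt_succ_self)
    refine ⟨((Finsupp.basis fun _ : ℕ => B).map (LinearEquiv.ofBijective _ hbij)).reindex
      (sigmaExpsEquiv n), fun s => ?_⟩
    obtain ⟨⟨k, t⟩, rfl⟩ := (sigmaExpsEquiv n).surjective s
    rw [Module.Basis.reindex_apply, Equiv.symm_apply_apply, Module.Basis.map_apply,
      Finsupp.coe_basis, LinearEquiv.ofBijective_apply, oreEval_single, hB, map_orderedMonomial,
      orderedMonomial_congr _ _ n hf]
    rfl

end OrePresentation

/-! ### The structure constants of the quantum group. -/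

section Coefficients

variable {K : Type u} [Field K]

/-- The scalars in the straightening relations of `U_q^+(G_2)`; the generators are numbered
from `0`. -/
def g2Coeff (q : K) : ℕ → ℕ → K
  | 1, 0 => q⁻¹ ^ 3
  | 2, 0 => q⁻¹
  | 2, 1 => q⁻¹ ^ 3
  | 3, 0 => 1
  | 3, 1 => q⁻¹ ^ 3
  | 3, 2 => q⁻¹ ^ 3
  | 4, 0 => q
  | 4, 1 => 1
  | 4, 2 => q⁻¹
  | 4, 3 => q⁻¹ ^ 3
  | 5, 0 => q ^ 3
  | 5, 1 => q ^ 3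
  | 5, 2 => 1
  | 5, 3 => q⁻¹ ^ 3
  | 5, 4 => q⁻¹ ^ 3
  | _, _ => 0

open FreeAlgebra in
/-- The lower terms in the straightening relations of `U_q^+(G_2)`. -/
def g2Tail (q : K) : ℕ → ℕ → FreeAlgebra K ℕ
  | 2, 0 => -((q + q⁻¹ + q⁻¹ ^ 3) • ι K 1)
  | 3, 0 => (1 - q ^ 2) • ι K 2 ^ 2
  | 3, 1 => -(((q ^ 4 - 2 * q ^ 2 + 1) / (q ^ 4 + q ^ 2 + 1)) • ι K 2 ^ 3)
  | 4, 0 => -((1 + q ^ 2) • ι K 2)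
  | 4, 1 => (1 - q ^ 2) • ι K 2 ^ 2
  | 4, 2 => -((q + q⁻¹ + q⁻¹ ^ 3) • ι K 3)
  | 5, 0 => -(q ^ 3 • ι K 4)
  | 5, 1 => (q ^ 4 + q ^ 2 - 1) • ι K 3 + (q ^ 2 - q ^ 4) • (ι K 2 * ι K 4)
  | 5, 2 => (1 - q ^ 2) • ι K 4 ^ 2
  | 5, 3 => -(((q ^ 4 - 2 * q ^ 2 + 1) / (q ^ 4 + q ^ 2 + 1)) • ι K 4 ^ 3)
  | _, _ => 0

theorem isLocal_g2Tail (q : K) : IsLocal (g2Tail q) := by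
  intro T _ _ y z i j hij h
  unfold g2Tail
  split <;> simp [h]

/-- Right-associated form of a straightening rule, so that rewriting also reaches pairs in the
interior of a word. -/
theorem mul_mul_of_straighten {T : Type u} [Ring T] [Algebra K T] {a b m : T} {k : K}
    (h : a * b = k • (b * a) + m) (z : T) : a * (b * z) = k • (b * (a * z)) + m * z := by
  rw [← mul_assoc, h, add_mul, smul_mul_assoc, mul_assoc]

theorem matrix_fin_two_ext {T : Type u} {M N : Matrix (Fin 2) (Fin 2) T} (h00 : M 0 0 = N 0 0)
    (h01 : M 0 1 = N 0 1) (h10 : M 1 0 = N 1 0) (h11 : M 1 1 = N 1 1) : M = N := by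
  rw [M.eta_fin_two, N.eta_fin_two, h00, h01, h10, h11]

end Coefficients

/-! ### Resolution of the overlap ambiguities. -/

section Overlaps

set_option linter.unusedSimpArgs false

variable {K : Type u} [Field K] {q : K}

theorem resolvesAt_two (hq0 : q ≠ 0) : ResolvesAt (g2Coeff q) (g2Tail q) 2 := by
  intro T _ _ y hy i j hij hj
  have h10 := hy 0 1 (by norm_num) (by norm_num)
  simp only [g2Coeff, g2Tail, map_zero, add_zero] at h10
  obtain ⟨rfl, rfl⟩ : i = 0 ∧ j = 1 := by omega
  apply matrix_fin_two_ext
  all_goals simp [skewMatrix, g2Coeff, g2Tail, Matrix.mul_apply, h10]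
  all_goals (match_scalars; field_simp)

/-- The nonvanishing hypothesis concerns q⁴ + q² + 1, a denominator of the relations, in nested
form. In each matrix relation the (0,0) entry says that σ respects the relation, the (0,1) entry
that δ does, and the (1,1) entry is the relation itself. -/
theorem resolvesAt_three (hq0 : q ≠ 0) (hq : q ^ 2 * (q ^ 2 + 1) + 1 ≠ 0) :
    ResolvesAt (g2Coeff q) (g2Tail q) 3 := by
  intro T _ _ y hy i j hij hj
  have h10 := hy 0 1 (by norm_num) (by norm_num)
  have h10' := mul_mul_of_straighten h10
  have h20 := hy 0 2 (by norm_num) (by norm_num)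
  have h20' := mul_mul_of_straighten h20
  have h21 := hy 1 2 (by norm_num) (by norm_num)
  have h21' := mul_mul_of_straighten h21
  simp only [g2Coeff, g2Tail, map_zero, add_zero, map_neg, map_smul, map_add, map_mul, map_pow,
    FreeAlgebra.lift_ι_apply, zero_mul]
    at h10 h10' h20 h20' h21 h21'
  have sq (z : T) : z ^ 2 = z * z := pow_two z
  have cube (z : T) : z ^ 3 = z * (z * z) := pow_three z
  have sq' (z : Matrix (Fin 2) (Fin 2) T) : z ^ 2 = z * z := pow_two z
  have cube' (z : Matrix (Fin 2) (Fin 2) T) : z ^ 3 = z * (z * z) := pow_three z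
  interval_cases j <;> interval_cases i <;> apply matrix_fin_two_ext
  -- Each entry is rewritten into ordered monomials, after which both sides are compared coefficient
  -- by coefficient.
  all_goals
    simp [skewMatrix, g2Coeff, g2Tail, sq, cube, sq', cube', Matrix.mul_apply, Fin.sum_univ_two,
      mul_add, add_mul, mul_assoc, h10, h10', h20, h20', h21, h21']
  all_goals match_scalars <;> field_simp <;> ring

set_option maxHeartbeats 1000000 in
theorem resolvesAt_four (hq0 : q ≠ 0) (hq : q ^ 2 * (q ^ 2 + 1) + 1 ≠ 0) :
    ResolvesAt (g2Coeff q) (g2Tail q) 4 := by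
  intro T _ _ y hy i j hij hj
  have h10 := hy 0 1 (by norm_num) (by norm_num)
  have h10' := mul_mul_of_straighten h10
  have h20 := hy 0 2 (by norm_num) (by norm_num)
  have h20' := mul_mul_of_straighten h20
  have h21 := hy 1 2 (by norm_num) (by norm_num)
  have h21' := mul_mul_of_straighten h21
  have h30 := hy 0 3 (by norm_num) (by norm_num)
  have h30' := mul_mul_of_straighten h30
  have h31 := hy 1 3 (by norm_num) (by norm_num)
  have h31' := mul_mul_of_straighten h31
  have h32 := hy 2 3 (by norm_num) (by norm_num)
  have h32' := mul_mul_of_straighten h32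
  simp only [g2Coeff, g2Tail, map_zero, add_zero, map_neg, map_smul, map_add, map_mul, map_pow,
    FreeAlgebra.lift_ι_apply, zero_mul]
    at h10 h10' h20 h20' h21 h21' h30 h30' h31 h31' h32 h32'
  have sq (z : T) : z ^ 2 = z * z := pow_two z
  have cube (z : T) : z ^ 3 = z * (z * z) := pow_three z
  have sq' (z : Matrix (Fin 2) (Fin 2) T) : z ^ 2 = z * z := pow_two z
  have cube' (z : Matrix (Fin 2) (Fin 2) T) : z ^ 3 = z * (z * z) := pow_three z
  interval_cases j <;> interval_cases i <;> apply matrix_fin_two_ext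
  all_goals
    simp [skewMatrix, g2Coeff, g2Tail, sq, cube, sq', cube', Matrix.mul_apply, Fin.sum_univ_two,
      mul_add, add_mul, mul_assoc, h10, h10', h20, h20', h21, h21', h30, h30', h31, h31', h32,
      h32']
  all_goals match_scalars <;> field_simp <;> ring

set_option maxHeartbeats 4000000 in
theorem resolvesAt_five (hq0 : q ≠ 0) (hq : q ^ 2 * (q ^ 2 + 1) + 1 ≠ 0) :
    ResolvesAt (g2Coeff q) (g2Tail q) 5 := by
  intro T _ _ y hy i j hij hj
  have h10 := hy 0 1 (by norm_num) (by norm_num)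
  have h10' := mul_mul_of_straighten h10
  have h20 := hy 0 2 (by norm_num) (by norm_num)
  have h20' := mul_mul_of_straighten h20
  have h21 := hy 1 2 (by norm_num) (by norm_num)
  have h21' := mul_mul_of_straighten h21
  have h30 := hy 0 3 (by norm_num) (by norm_num)
  have h30' := mul_mul_of_straighten h30
  have h31 := hy 1 3 (by norm_num) (by norm_num)
  have h31' := mul_mul_of_straighten h31
  have h32 := hy 2 3 (by norm_num) (by norm_num)
  have h32' := mul_mul_of_straighten h32
  have h40 := hy 0 4 (by norm_num) (by norm_num)
  have h40' := mul_mul_of_straighten h40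
  have h41 := hy 1 4 (by norm_num) (by norm_num)
  have h41' := mul_mul_of_straighten h41
  have h42 := hy 2 4 (by norm_num) (by norm_num)
  have h42' := mul_mul_of_straighten h42
  have h43 := hy 3 4 (by norm_num) (by norm_num)
  have h43' := mul_mul_of_straighten h43
  simp only [g2Coeff, g2Tail, map_zero, add_zero, map_neg, map_smul, map_add, map_mul, map_pow,
    FreeAlgebra.lift_ι_apply, zero_mul]
    at h10 h10' h20 h20' h21 h21' h30 h30' h31 h31' h32 h32' h40 h40' h41 h41' h42 h42' h43 h43'
  have sq (z : T) : z ^ 2 = z * z := pow_two z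
  have cube (z : T) : z ^ 3 = z * (z * z) := pow_three z
  have sq' (z : Matrix (Fin 2) (Fin 2) T) : z ^ 2 = z * z := pow_two z
  have cube' (z : Matrix (Fin 2) (Fin 2) T) : z ^ 3 = z * (z * z) := pow_three z
  interval_cases j <;> interval_cases i <;> apply matrix_fin_two_ext
  all_goals
    simp [skewMatrix, g2Coeff, g2Tail, sq, cube, sq', cube', Matrix.mul_apply, Fin.sum_univ_two,
      mul_add, add_mul, mul_assoc, h10, h10', h20, h20', h21, h21', h30, h30', h31, h31', h32,
      h32', h40, h40', h41, h41', h42, h42', h43, h43']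
  all_goals match_scalars <;> field_simp <;> ring

end Overlaps

/-! ### Identification of the numbered presentation with the algebra of the theorem. -/

section Presentation

variable {K : Type u} [Field K] {q : K}

/-- The position of a generator in the ordering. -/
def Gen.index : Gen → ℕ
  | .E1 => 0
  | .E2 => 1
  | .E3 => 2
  | .E4 => 3
  | .E5 => 4
  | .E6 => 5

/-- The root vectors as a sequence, extended by zero. -/
noncomputable def rootVec (q : K) : ℕ → UqG2 K q
  | 0 => E q .E1
  | 1 => E q .E2
  | 2 => E q .E3
  | 3 => E q .E4
  | 4 => E q .E5
  | 5 => E q .E6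
  | _ => 0

theorem straightens_rootVec : Straightens (g2Coeff q) (g2Tail q) 6 (rootVec q) := by
  intro i j hij hj
  have key {a b : FreeAlgebra K Gen} (h : Rel K q a b) :=
    RingQuot.mkAlgHom_rel K h
  interval_cases j <;> interval_cases i <;>
    simp only [g2Coeff, g2Tail, rootVec, map_zero, add_zero, map_neg, map_smul, map_add, map_mul,
      map_pow, FreeAlgebra.lift_ι_apply, ← sub_eq_add_neg, one_smul]
  · simpa [E] using key Rel.r21
  · simpa [E] using key Rel.r31
  · simpa [E] using key Rel.r32
  · simpa [E] using key Rel.r41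
  · simpa [E] using key Rel.r42
  · simpa [E] using key Rel.r43
  · simpa [E] using key Rel.r51
  · simpa [E] using key Rel.r52
  · simpa [E] using key Rel.r53
  · simpa [E] using key Rel.r54
  · simpa [E] using key Rel.r61
  · simpa [E, add_assoc] using key Rel.r62
  · simpa [E] using key Rel.r63
  · simpa [E] using key Rel.r64
  · simpa [E] using key Rel.r65

theorem exists_uqLift {T : Type u} [Ring T] [Algebra K T] (y : ℕ → T)
    (hy : Straightens (g2Coeff q) (g2Tail q) 6 y) :
    ∃ f : UqG2 K q →ₐ[K] T, ∀ i, f (E q i) = y i.index := by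
  refine ⟨RingQuot.liftAlgHom K ⟨FreeAlgebra.lift K fun i => y i.index, fun a b h => ?_⟩,
    fun i => (RingQuot.liftAlgHom_mkAlgHom_apply ..).trans (FreeAlgebra.lift_ι_apply ..)⟩
  cases h <;>
    simp only [map_smul, map_add, map_sub, map_mul, map_pow, gen,
      FreeAlgebra.lift_ι_apply, Gen.index]
  · simpa [g2Coeff, g2Tail] using hy 0 1 (by norm_num) (by norm_num)
  · simpa [g2Coeff, g2Tail, sub_eq_add_neg] using hy 0 2 (by norm_num) (by norm_num)
  · simpa [g2Coeff, g2Tail] using hy 1 2 (by norm_num) (by norm_num)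
  · simpa [g2Coeff, g2Tail] using hy 0 3 (by norm_num) (by norm_num)
  · simpa [g2Coeff, g2Tail, sub_eq_add_neg] using hy 1 3 (by norm_num) (by norm_num)
  · simpa [g2Coeff, g2Tail] using hy 2 3 (by norm_num) (by norm_num)
  · simpa [g2Coeff, g2Tail, sub_eq_add_neg] using hy 0 4 (by norm_num) (by norm_num)
  · simpa [g2Coeff, g2Tail] using hy 1 4 (by norm_num) (by norm_num)
  · simpa [g2Coeff, g2Tail, sub_eq_add_neg] using hy 2 4 (by norm_num) (by norm_num)
  · simpa [g2Coeff, g2Tail] using hy 3 4 (by norm_num) (by norm_num)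
  · simpa [g2Coeff, g2Tail, sub_eq_add_neg] using hy 0 5 (by norm_num) (by norm_num)
  · simpa [g2Coeff, g2Tail, add_assoc] using hy 1 5 (by norm_num) (by norm_num)
  · simpa [g2Coeff, g2Tail] using hy 2 5 (by norm_num) (by norm_num)
  · simpa [g2Coeff, g2Tail, sub_eq_add_neg] using hy 3 5 (by norm_num) (by norm_num)
  · simpa [g2Coeff, g2Tail] using hy 4 5 (by norm_num) (by norm_num)

theorem uqAlgHom_ext {T : Type u} [Ring T] [Algebra K T] {f g : UqG2 K q →ₐ[K] T}
    (h : ∀ i, f (E q i) = g (E q i)) : f = g := by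
  apply RingQuot.ringQuot_ext'
  apply FreeAlgebra.hom_ext
  ext i
  exact h i

theorem exists_equiv_oreAlg :
    ∃ f : OreAlg (g2Coeff q) (g2Tail q) 6 ≃ₐ[K] UqG2 K q,
      ∀ i, f (oreGen _ _ 6 i) = rootVec q i := by
  obtain ⟨f, hf⟩ := exists_oreLift 6 (rootVec q) straightens_rootVec
    (fun j hj => by
      obtain ⟨k, rfl⟩ := Nat.exists_eq_add_of_le' hj
      rfl)
  obtain ⟨g, hg⟩ := exists_uqLift _ (straightens_oreGen (c := g2Coeff q) (d := g2Tail q) 6)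
  have hfg : f.comp g = AlgHom.id K _ := uqAlgHom_ext fun i => by
    cases i <;> simp [hg, hf, Gen.index, rootVec]
  have hgf : ∀ r, g (f r) = r := by
    intro r
    induction r using OreAlg.induction with
    | hgen i =>
      rw [hf]
      by_cases hi : i < 6
      · interval_cases i <;> simp [rootVec, hg, Gen.index]
      · rw [oreGen_eq_zero (not_lt.mp hi)]
        obtain ⟨k, rfl⟩ := Nat.exists_eq_add_of_le' (not_lt.mp hi)
        exact map_zero g
    | halg k => simp only [AlgHom.commutes]
    | hadd a b ha hb => simp only [map_add, ha, hb]
    | hmul a b ha hb => simp only [map_mul, ha, hb]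
  exact ⟨AlgEquiv.ofAlgHom f g hfg (AlgHom.ext hgf), hf⟩

/-- Ordered monomials in the first six elements of `y`. -/
def sixMonomial {T : Type u} [Ring T] (y : ℕ → T) : ℕ × ℕ × ℕ × ℕ × ℕ × ℕ → T
  | (i, j, k, l, m, n) => y 0 ^ i * y 1 ^ j * y 2 ^ k * y 3 ^ l * y 4 ^ m * y 5 ^ n

/-- Exponents of ordered monomials in six generators as tuples. -/
def expsSixEquiv : Exps 6 ≃ ℕ × ℕ × ℕ × ℕ × ℕ × ℕ where
  toFun := fun ((((((_, i), j), k), l), m), n) => (i, j, k, l, m, n)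
  invFun := fun (i, j, k, l, m, n) => (((((((), i), j), k), l), m), n)
  left_inv _ := rfl
  right_inv _ := rfl

theorem exists_basis_sixMonomial (hq0 : q ≠ 0) (hq : q ^ 2 * (q ^ 2 + 1) + 1 ≠ 0) :
    ∃ B : Module.Basis (ℕ × ℕ × ℕ × ℕ × ℕ × ℕ) K (UqG2 K q),
      ∀ s, B s = sixMonomial (rootVec q) s := by
  obtain ⟨B, hB⟩ := exists_basis_orderedMonomial (isLocal_g2Tail q) 6 (c := g2Coeff q) (by
    intro m hm
    interval_cases m
    · exact fun T _ _ y hy i j hij hj => absurd hj (Nat.not_lt_zero j)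
    · exact fun T _ _ y hy i j hij hj => by omega
    · exact resolvesAt_two hq0
    · exact resolvesAt_three hq0 hq
    · exact resolvesAt_four hq0 hq
    · exact resolvesAt_five hq0 hq)
  obtain ⟨f, hf⟩ := exists_equiv_oreAlg (q := q)
  refine ⟨(B.map f.toLinearEquiv).reindex expsSixEquiv, fun s => ?_⟩
  obtain ⟨t, rfl⟩ := expsSixEquiv.surjective s
  rw [Module.Basis.reindex_apply, Equiv.symm_apply_apply, Module.Basis.map_apply, hB]
  refine (map_orderedMonomial f.toAlgHom _ 6 t).trans ?_
  have h : (fun i => f.toAlgHom (oreGen (g2Coeff q) (g2Tail q) 6 i)) = rootVec q := funext hf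
  rw [h]
  simp only [orderedMonomial, one_mul]
  rfl

end Presentation

/-! ### Centrality of Ω₁ and Ω₂. -/

section Central

variable {K : Type u} [Field K] {q : K}

theorem commute_of_forall_gen {z : UqG2 K q} (h : ∀ i, Commute z (E q i)) (x : UqG2 K q) :
    Commute z x := by
  obtain ⟨w, rfl⟩ := RingQuot.mkAlgHom_surjective K (Rel K q) x
  induction w using FreeAlgebra.induction with
  | grade0 k => rw [AlgHom.commutes]; exact Algebra.commute_algebraMap_right k z
  | grade1 i => exact h i
  | mul a b ha hb => rw [map_mul]; exact ha.mul_right hb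
  | add a b ha hb => rw [map_add]; exact ha.add_right hb

/-- This and the next lemmas rewrite the scalars so that the only denominators are products of q² -
1 and q⁴ + q² + 1, both known to be nonzero. -/
theorem cA_eq (hq0 : q ≠ 0) (hq2 : q ^ 2 - 1 ≠ 0) :
    cA q = -((q ^ 4 + q ^ 2 + 1) / (q ^ 2 - 1)) := by
  have h : q⁻¹ ^ 2 - 1 = -((q ^ 2 - 1) / q ^ 2) := by field_simp; ring
  rw [cA, h]
  field_simp

theorem pow_six_sub_one : q ^ 6 - 1 = (q ^ 2 - 1) * (q ^ 4 + q ^ 2 + 1) := by ring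

theorem cB_eq (hq0 : q ≠ 0) (hq2 : q ^ 2 - 1 ≠ 0) :
    cB q = -(q ^ 9 * (q ^ 2 - 1) / (q ^ 4 + q ^ 2 + 1) ^ 2) := by
  have h : 1 - q⁻¹ ^ 6 = (q ^ 2 - 1) * (q ^ 4 + q ^ 2 + 1) / q ^ 6 := by
    rw [← pow_six_sub_one]; field_simp
  rw [cB, h]
  field_simp
  ring

theorem cB'_eq : cB' q = q ^ 11 * (q ^ 2 - 1) / (q ^ 4 + q ^ 2 + 1) ^ 2 := by
  rw [cB']; ring

theorem cD'_eq : cD' q = q ^ 12 / ((q ^ 2 - 1) * (q ^ 4 + q ^ 2 + 1)) := by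
  rw [cD', pow_six_sub_one]

set_option linter.unusedSimpArgs false

set_option maxHeartbeats 4000000 in
-- A direct check: both products are straightened to ordered monomials and their coefficients agree.
theorem commute_Omega1_of_straightens (hq0 : q ≠ 0) (hq : q ^ 2 * (q ^ 2 + 1) + 1 ≠ 0)
    (hq2 : q ^ 2 - 1 ≠ 0) {T : Type u} [Ring T] [Algebra K T] {y : ℕ → T}
    (hy : Straightens (g2Coeff q) (g2Tail q) 6 y) {i : ℕ} (hi : i < 6) :
    Commute (y 0 * y 2 * y 4 + cA q • (y 0 * y 3) + cA q • (y 1 * y 4) + cA' q • y 2 ^ 2)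
      (y i) := by
  have h10 := hy 0 1 (by norm_num) (by norm_num)
  have h10' := mul_mul_of_straighten h10
  have h20 := hy 0 2 (by norm_num) (by norm_num)
  have h20' := mul_mul_of_straighten h20
  have h21 := hy 1 2 (by norm_num) (by norm_num)
  have h21' := mul_mul_of_straighten h21
  have h30 := hy 0 3 (by norm_num) (by norm_num)
  have h30' := mul_mul_of_straighten h30
  have h31 := hy 1 3 (by norm_num) (by norm_num)
  have h31' := mul_mul_of_straighten h31
  have h32 := hy 2 3 (by norm_num) (by norm_num)
  have h32' := mul_mul_of_straighten h32
  have h40 := hy 0 4 (by norm_num) (by norm_num)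
  have h40' := mul_mul_of_straighten h40
  have h41 := hy 1 4 (by norm_num) (by norm_num)
  have h41' := mul_mul_of_straighten h41
  have h42 := hy 2 4 (by norm_num) (by norm_num)
  have h42' := mul_mul_of_straighten h42
  have h43 := hy 3 4 (by norm_num) (by norm_num)
  have h43' := mul_mul_of_straighten h43
  have h50 := hy 0 5 (by norm_num) (by norm_num)
  have h50' := mul_mul_of_straighten h50
  have h51 := hy 1 5 (by norm_num) (by norm_num)
  have h51' := mul_mul_of_straighten h51
  have h52 := hy 2 5 (by norm_num) (by norm_num)
  have h52' := mul_mul_of_straighten h52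
  have h53 := hy 3 5 (by norm_num) (by norm_num)
  have h53' := mul_mul_of_straighten h53
  have h54 := hy 4 5 (by norm_num) (by norm_num)
  have h54' := mul_mul_of_straighten h54
  simp only [g2Coeff, g2Tail, map_zero, add_zero, map_neg, map_smul, map_add, map_mul, map_pow,
    FreeAlgebra.lift_ι_apply, zero_mul]
    at h10 h10' h20 h20' h21 h21' h30 h30' h31 h31' h32 h32' h40 h40' h41 h41' h42 h42' h43 h43'
        h50 h50' h51 h51' h52 h52' h53 h53' h54 h54'
  have sq (z : T) : z ^ 2 = z * z := pow_two z
  have cube (z : T) : z ^ 3 = z * (z * z) := pow_three z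
  interval_cases i
  all_goals
    simp [Commute, SemiconjBy, cA_eq hq0 hq2, cA', sq, cube,
      mul_add, add_mul, mul_assoc, h10, h10', h20, h20', h21, h21', h30, h30', h31, h31', h32,
      h32', h40, h40', h41, h41', h42, h42', h43, h43', h50, h50', h51, h51', h52, h52', h53, h53',
      h54, h54']
  all_goals match_scalars <;> field_simp <;> ring

set_option maxHeartbeats 4000000 in
theorem commute_Omega2_of_straightens (hq0 : q ≠ 0) (hq : q ^ 2 * (q ^ 2 + 1) + 1 ≠ 0)
    (hq2 : q ^ 2 - 1 ≠ 0) {T : Type u} [Ring T] [Algebra K T] {y : ℕ → T}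
    (hy : Straightens (g2Coeff q) (g2Tail q) 6 y) {i : ℕ} (hi : i < 6) :
    Commute (y 1 * y 3 * y 5 + cB q • (y 1 * y 4 ^ 3) + cB q • (y 2 ^ 3 * y 5)
      + cB' q • (y 2 ^ 2 * y 4 ^ 2) + cC' q • (y 2 * y 3 * y 4) + cD' q • y 3 ^ 2) (y i) := by
  have h10 := hy 0 1 (by norm_num) (by norm_num)
  have h10' := mul_mul_of_straighten h10
  have h20 := hy 0 2 (by norm_num) (by norm_num)
  have h20' := mul_mul_of_straighten h20
  have h21 := hy 1 2 (by norm_num) (by norm_num)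
  have h21' := mul_mul_of_straighten h21
  have h30 := hy 0 3 (by norm_num) (by norm_num)
  have h30' := mul_mul_of_straighten h30
  have h31 := hy 1 3 (by norm_num) (by norm_num)
  have h31' := mul_mul_of_straighten h31
  have h32 := hy 2 3 (by norm_num) (by norm_num)
  have h32' := mul_mul_of_straighten h32
  have h40 := hy 0 4 (by norm_num) (by norm_num)
  have h40' := mul_mul_of_straighten h40
  have h41 := hy 1 4 (by norm_num) (by norm_num)
  have h41' := mul_mul_of_straighten h41
  have h42 := hy 2 4 (by norm_num) (by norm_num)
  have h42' := mul_mul_of_straighten h42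
  have h43 := hy 3 4 (by norm_num) (by norm_num)
  have h43' := mul_mul_of_straighten h43
  have h50 := hy 0 5 (by norm_num) (by norm_num)
  have h50' := mul_mul_of_straighten h50
  have h51 := hy 1 5 (by norm_num) (by norm_num)
  have h51' := mul_mul_of_straighten h51
  have h52 := hy 2 5 (by norm_num) (by norm_num)
  have h52' := mul_mul_of_straighten h52
  have h53 := hy 3 5 (by norm_num) (by norm_num)
  have h53' := mul_mul_of_straighten h53
  have h54 := hy 4 5 (by norm_num) (by norm_num)
  have h54' := mul_mul_of_straighten h54
  simp only [g2Coeff, g2Tail, map_zero, add_zero, map_neg, map_smul, map_add, map_mul, map_pow,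
    FreeAlgebra.lift_ι_apply, zero_mul]
    at h10 h10' h20 h20' h21 h21' h30 h30' h31 h31' h32 h32' h40 h40' h41 h41' h42 h42' h43 h43'
        h50 h50' h51 h51' h52 h52' h53 h53' h54 h54'
  have sq (z : T) : z ^ 2 = z * z := pow_two z
  have cube (z : T) : z ^ 3 = z * (z * z) := pow_three z
  interval_cases i
  all_goals
    simp [Commute, SemiconjBy, cB_eq hq0 hq2, cB'_eq, cC', cD'_eq, sq, cube,
      mul_add, add_mul, mul_assoc, h10, h10', h20, h20', h21, h21', h30, h30', h31, h31', h32,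
      h32', h40, h40', h41, h41', h42, h42', h43, h43', h50, h50', h51, h51', h52, h52', h53, h53',
      h54, h54']
  all_goals match_scalars <;> field_simp <;> ring

theorem commute_Omega1 (hq0 : q ≠ 0) (hq : q ^ 2 * (q ^ 2 + 1) + 1 ≠ 0)
    (hq2 : q ^ 2 - 1 ≠ 0) (x : UqG2 K q) : Commute (Omega1 q) x := by
  refine commute_of_forall_gen (fun i => ?_) x
  have h {i : ℕ} (hi : i < 6) :=
    commute_Omega1_of_straightens hq0 hq hq2 (straightens_rootVec (q := q)) hi
  cases i
  · exact h (i := 0) (by norm_num)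
  · exact h (i := 1) (by norm_num)
  · exact h (i := 2) (by norm_num)
  · exact h (i := 3) (by norm_num)
  · exact h (i := 4) (by norm_num)
  · exact h (i := 5) (by norm_num)

theorem commute_Omega2 (hq0 : q ≠ 0) (hq : q ^ 2 * (q ^ 2 + 1) + 1 ≠ 0)
    (hq2 : q ^ 2 - 1 ≠ 0) (x : UqG2 K q) : Commute (Omega2 q) x := by
  refine commute_of_forall_gen (fun i => ?_) x
  have h {i : ℕ} (hi : i < 6) :=
    commute_Omega2_of_straightens hq0 hq hq2 (straightens_rootVec (q := q)) hi
  cases i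
  · exact h (i := 0) (by norm_num)
  · exact h (i := 1) (by norm_num)
  · exact h (i := 2) (by norm_num)
  · exact h (i := 3) (by norm_num)
  · exact h (i := 4) (by norm_num)
  · exact h (i := 5) (by norm_num)

end Central

/-! ### The weight filtration and the leading terms of multiplication by Ω₁ and Ω₂. -/

section Filtration

variable {K : Type u} [Field K] {q : K} {T : Type u} [Ring T] [Algebra K T] {y : ℕ → T}

theorem mul_pow_of_qCommute {a b : T} {k : K} (h : a * b = k • (b * a)) (n : ℕ) :
    a * b ^ n = k ^ n • (b ^ n * a) := by
  induction n with
  | zero => simp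
  | succ n ih =>
    rw [pow_succ, ← mul_assoc, ih, smul_mul_assoc, mul_assoc, h, mul_smul_comm, smul_smul,
      pow_succ, mul_assoc]

theorem pow_mul_pow_of_qCommute {a b : T} {k : K} (h : a * b = k • (b * a)) (m n : ℕ) :
    a ^ m * b ^ n = k ^ (n * m) • (b ^ n * a ^ m) := by
  induction m with
  | zero => simp
  | succ m ih =>
    rw [pow_succ', mul_assoc, ih, mul_smul_comm, ← mul_assoc, mul_pow_of_qCommute h,
      smul_mul_assoc, smul_smul, mul_assoc, ← pow_add, Nat.mul_succ, add_comm]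

/-- The weight of an ordered monomial; only the two middle exponents matter. -/
def weight : ℕ × ℕ × ℕ × ℕ × ℕ × ℕ → ℕ
  | (_, _, k, l, _, _) => 3 * k + 5 * l

variable (K) in
/-- The span of the ordered monomials of weight less than `N`. -/
def lowerSpan (y : ℕ → T) (N : ℕ) : Submodule K T :=
  Submodule.span K (sixMonomial y '' {s | weight s < N})

theorem sixMonomial_mem {N : ℕ} (i j k l m n : ℕ) (h : 3 * k + 5 * l < N) :
    sixMonomial y (i, j, k, l, m, n) ∈ lowerSpan K y N :=
  Submodule.subset_span ⟨(i, j, k, l, m, n), h, rfl⟩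

theorem lowerSpan_mono {M N : ℕ} (h : M ≤ N) : lowerSpan K y M ≤ lowerSpan K y N :=
  Submodule.span_mono (Set.image_mono fun _ hs => lt_of_lt_of_le hs h)

/-- The correction trades one `E3` for an `E2`, so it loses weight. -/
theorem exists_y2_pow_mul_y0 (hy : Straightens (g2Coeff q) (g2Tail q) 6 y) (k : ℕ) :
    ∃ c₁ c₂ : K, y 2 ^ k * y 0 = c₁ • (y 0 * y 2 ^ k) + c₂ • (y 1 * y 2 ^ (k - 1)) := by
  have h20 := hy 0 2 (by norm_num) (by norm_num)
  have h21 := hy 1 2 (by norm_num) (by norm_num)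
  simp only [g2Coeff, g2Tail, map_zero, map_neg, map_smul, FreeAlgebra.lift_ι_apply,
    add_zero] at h20 h21
  rcases k with _ | k
  · exact ⟨1, 0, by simp⟩
  induction k with
  | zero => exact ⟨_, _, by simpa [← neg_smul] using h20⟩
  | succ k ih =>
    obtain ⟨c₁, c₂, h⟩ := ih
    refine ⟨c₁ * q⁻¹, c₁ * -(q + q⁻¹ + q⁻¹ ^ 3) + c₂ * q⁻¹ ^ 3, ?_⟩
    simp only [Nat.add_sub_cancel] at h ⊢
    rw [pow_succ' _ (k + 1), mul_assoc, h, mul_add, mul_smul_comm, mul_smul_comm, ← mul_assoc,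
      ← mul_assoc, h20, h21, pow_succ' _ k]
    simp only [add_mul, neg_mul, smul_mul_assoc, mul_assoc]
    module

/-- The correction trades one `E4` for E₃³ and gains weight 4, which is affordable because the terms
of Ω₂ containing `E2` have weight at most 5, against 10. The disjunction covers `l = 0`, where `l -
1` truncates and the correction must be absent. -/
theorem exists_y3_pow_mul_y1 (hy : Straightens (g2Coeff q) (g2Tail q) 6 y) (l : ℕ) :
    ∃ c₁ c₂ : K, (c₂ = 0 ∨ 0 < l) ∧
      y 3 ^ l * y 1 = c₁ • (y 1 * y 3 ^ l) + c₂ • (y 2 ^ 3 * y 3 ^ (l - 1)) := by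
  have h31 := hy 1 3 (by norm_num) (by norm_num)
  have h32 := hy 2 3 (by norm_num) (by norm_num)
  simp only [g2Coeff, g2Tail, map_zero, map_neg, map_smul, map_pow, FreeAlgebra.lift_ι_apply,
    add_zero] at h31 h32
  have h32' := mul_pow_of_qCommute h32 3
  rcases l with _ | l
  · exact ⟨1, 0, Or.inl rfl, by simp⟩
  induction l with
  | zero => exact ⟨_, _, Or.inr one_pos, by simpa [← neg_smul] using h31⟩
  | succ l ih =>
    obtain ⟨c₁, c₂, -, h⟩ := ih
    refine ⟨c₁ * q⁻¹ ^ 3, c₁ * -((q ^ 4 - 2 * q ^ 2 + 1) / (q ^ 4 + q ^ 2 + 1)) +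
      c₂ * (q⁻¹ ^ 3) ^ 3, Or.inr (Nat.succ_pos _), ?_⟩
    simp only [Nat.add_sub_cancel] at h ⊢
    rw [pow_succ' _ (l + 1), mul_assoc, h, mul_add, mul_smul_comm, mul_smul_comm, ← mul_assoc,
      ← mul_assoc, h31, h32', pow_succ' _ l]
    simp only [add_mul, neg_mul, smul_mul_assoc, mul_assoc]
    module

/-- Multiplication by the outer generators preserves the weight. -/
theorem exists_outer_mul_sixMonomial (hy : Straightens (g2Coeff q) (g2Tail q) 6 y)
    (i j m n i' j' k l m' n' : ℕ) :
    ∃ c : K, y 0 ^ i * y 1 ^ j * sixMonomial y (i', j', k, l, m', n') * (y 4 ^ m * y 5 ^ n) =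
      c • sixMonomial y (i + i', j + j', k, l, m' + m, n' + n) := by
  have h10 := hy 0 1 (by norm_num) (by norm_num)
  have h54 := hy 4 5 (by norm_num) (by norm_num)
  simp only [g2Coeff, g2Tail, map_zero, add_zero] at h10 h54
  have e1 : y 0 ^ i * y 1 ^ j * (y 0 ^ i' * y 1 ^ j') =
      (q⁻¹ ^ 3) ^ (i' * j) • (y 0 ^ (i + i') * y 1 ^ (j + j')) := by
    rw [pow_add, pow_add, mul_assoc, ← mul_assoc (y 1 ^ j), pow_mul_pow_of_qCommute h10]
    simp only [smul_mul_assoc, mul_smul_comm, mul_assoc]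
  have e2 : y 4 ^ m' * y 5 ^ n' * (y 4 ^ m * y 5 ^ n) =
      (q⁻¹ ^ 3) ^ (m * n') • (y 4 ^ (m' + m) * y 5 ^ (n' + n)) := by
    rw [pow_add, pow_add, mul_assoc, ← mul_assoc (y 5 ^ n'), pow_mul_pow_of_qCommute h54]
    simp only [smul_mul_assoc, mul_smul_comm, mul_assoc]
  refine ⟨(q⁻¹ ^ 3) ^ (i' * j) * (q⁻¹ ^ 3) ^ (m * n'), ?_⟩
  calc _ = (y 0 ^ i * y 1 ^ j * (y 0 ^ i' * y 1 ^ j')) * (y 2 ^ k * y 3 ^ l) *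
        (y 4 ^ m' * y 5 ^ n' * (y 4 ^ m * y 5 ^ n)) := by
        simp only [sixMonomial, mul_assoc]
    _ = _ := by
        rw [e1, e2]
        simp only [sixMonomial, smul_mul_assoc, mul_smul_comm, smul_smul, mul_assoc]
        rw [mul_comm]

/-- Since `E1`, `E2` q-commute, and so do `E5`, `E6`, flanking an ordered monomial with them only
rescales and changes outer exponents. Leading terms can thus be computed on the inner factor in `E3`
and `E4` alone. -/
theorem outer_mul_mem (hy : Straightens (g2Coeff q) (g2Tail q) 6 y) (i j m n : ℕ) {N : ℕ} {v : T}
    (hv : v ∈ lowerSpan K y N) :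
    y 0 ^ i * y 1 ^ j * v * (y 4 ^ m * y 5 ^ n) ∈ lowerSpan K y N := by
  induction hv using Submodule.span_induction with
  | mem x hx =>
    obtain ⟨⟨i', j', k, l, m', n'⟩, hs, rfl⟩ := hx
    obtain ⟨c, hc⟩ := exists_outer_mul_sixMonomial hy i j m n i' j' k l m' n'
    rw [hc]
    exact Submodule.smul_mem _ _ (sixMonomial_mem _ _ _ _ _ _ hs)
  | zero => simp
  | add a b _ _ ha hb => rw [mul_add, add_mul]; exact Submodule.add_mem _ ha hb
  | smul c a _ ha => rw [mul_smul_comm, smul_mul_assoc]; exact Submodule.smul_mem _ _ ha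

/-- Placed between the powers of `E3` and `E4`, Ω₁ never requires moving `E1` past `E4`, which would
create E₃². Only `E1`, `E2` pass `E3` and `E5` passes `E4`. -/
theorem inner_Omega1_mem (hy : Straightens (g2Coeff q) (g2Tail q) 6 y) (a a' : K) (k l : ℕ) :
    y 2 ^ k * (y 0 * y 2 * y 4 + a • (y 0 * y 3) + a • (y 1 * y 4) + a' • y 2 ^ 2) * y 3 ^ l
      - a' • (y 2 ^ (k + 2) * y 3 ^ l) ∈ lowerSpan K y (3 * k + 5 * l + 6) := by
  obtain ⟨c₁, c₂, h⟩ := exists_y2_pow_mul_y0 hy k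
  have h21 := hy 1 2 (by norm_num) (by norm_num)
  have h43 := hy 3 4 (by norm_num) (by norm_num)
  simp only [g2Coeff, g2Tail, map_zero, add_zero] at h21 h43
  have p21 := pow_mul_pow_of_qCommute h21 k 1
  have p43 := mul_pow_of_qCommute h43 l
  rw [pow_one] at p21
  set κ := (q⁻¹ ^ 3) ^ (1 * k)
  set ρ := (q⁻¹ ^ 3) ^ l
  have key : y 2 ^ k * (y 0 * y 2 * y 4 + a • (y 0 * y 3) + a • (y 1 * y 4) + a' • y 2 ^ 2) *
      y 3 ^ l - a' • (y 2 ^ (k + 2) * y 3 ^ l) =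
      (c₁ * ρ) • sixMonomial y (1, 0, k + 1, l, 1, 0) +
      (c₂ * ρ) • sixMonomial y (0, 1, k - 1 + 1, l, 1, 0) +
      (a * c₁) • sixMonomial y (1, 0, k, l + 1, 0, 0) +
      (a * c₂) • sixMonomial y (0, 1, k - 1, l + 1, 0, 0) +
      (a * κ * ρ) • sixMonomial y (0, 1, k, l, 1, 0) := by
    have h' (z : T) : y 2 ^ k * (y 0 * z) =
        c₁ • (y 0 * (y 2 ^ k * z)) + c₂ • (y 1 * (y 2 ^ (k - 1) * z)) := by
      rw [← mul_assoc, h, add_mul]; simp only [smul_mul_assoc, mul_assoc]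
    have p21' (z : T) : y 2 ^ k * (y 1 * z) = κ • (y 1 * (y 2 ^ k * z)) := by
      rw [← mul_assoc, p21, smul_mul_assoc, mul_assoc]
    simp only [sixMonomial, mul_add, add_mul, mul_assoc, smul_mul_assoc, mul_smul_comm, smul_add,
      smul_smul, pow_zero, pow_one, one_mul, mul_one, h', p21', p43, pow_add _ k 2,
      pow_succ' _ l, pow_succ _ k, pow_succ _ (k - 1)]
    module
  rw [key]
  refine Submodule.add_mem _ (Submodule.add_mem _ (Submodule.add_mem _ (Submodule.add_mem _ ?_ ?_)
    ?_) ?_) ?_ <;> exact Submodule.smul_mem _ _ (sixMonomial_mem _ _ _ _ _ _ (by omega))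

/-- Here Ω₂ stands after both powers, so its factors `E5`, `E6` are already in place and only `E2`,
`E3` have to travel left. -/
theorem inner_Omega2_mem (hy : Straightens (g2Coeff q) (g2Tail q) 6 y) (b b' c' d' : K)
    (k l : ℕ) :
    y 2 ^ k * y 3 ^ l * (y 1 * y 3 * y 5 + b • (y 1 * y 4 ^ 3) + b • (y 2 ^ 3 * y 5)
      + b' • (y 2 ^ 2 * y 4 ^ 2) + c' • (y 2 * y 3 * y 4) + d' • y 3 ^ 2)
      - d' • (y 2 ^ k * y 3 ^ (l + 2)) ∈ lowerSpan K y (3 * k + 5 * l + 10) := by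
  obtain ⟨c₁, c₂, hc, h⟩ := exists_y3_pow_mul_y1 hy l
  have h21 := hy 1 2 (by norm_num) (by norm_num)
  have h32 := hy 2 3 (by norm_num) (by norm_num)
  simp only [g2Coeff, g2Tail, map_zero, add_zero] at h21 h32
  have p21 := pow_mul_pow_of_qCommute h21 k 1
  have p32 := pow_mul_pow_of_qCommute h32 l
  rw [pow_one] at p21
  set κ := (q⁻¹ ^ 3) ^ (1 * k)
  have key : y 2 ^ k * y 3 ^ l * (y 1 * y 3 * y 5 + b • (y 1 * y 4 ^ 3) + b • (y 2 ^ 3 * y 5)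
      + b' • (y 2 ^ 2 * y 4 ^ 2) + c' • (y 2 * y 3 * y 4) + d' • y 3 ^ 2)
      - d' • (y 2 ^ k * y 3 ^ (l + 2)) =
      (c₁ * κ) • sixMonomial y (0, 1, k, l + 1, 0, 1) +
      c₂ • sixMonomial y (0, 0, k + 3, l - 1 + 1, 0, 1) +
      (b * c₁ * κ) • sixMonomial y (0, 1, k, l, 3, 0) +
      (b * c₂) • sixMonomial y (0, 0, k + 3, l - 1, 3, 0) +
      (b * (q⁻¹ ^ 3) ^ (3 * l)) • sixMonomial y (0, 0, k + 3, l, 0, 1) +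
      (b' * (q⁻¹ ^ 3) ^ (2 * l)) • sixMonomial y (0, 0, k + 2, l, 2, 0) +
      (c' * (q⁻¹ ^ 3) ^ (1 * l)) • sixMonomial y (0, 0, k + 1, l + 1, 1, 0) := by
    have h' (z : T) : y 3 ^ l * (y 1 * z) =
        c₁ • (y 1 * (y 3 ^ l * z)) + c₂ • (y 2 ^ 3 * (y 3 ^ (l - 1) * z)) := by
      rw [← mul_assoc, h, add_mul]; simp only [smul_mul_assoc, mul_assoc]
    have p21' (z : T) : y 2 ^ k * (y 1 * z) = κ • (y 1 * (y 2 ^ k * z)) := by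
      rw [← mul_assoc, p21, smul_mul_assoc, mul_assoc]
    have p32' (n : ℕ) (z : T) : y 3 ^ l * (y 2 ^ n * z) =
        (q⁻¹ ^ 3) ^ (n * l) • (y 2 ^ n * (y 3 ^ l * z)) := by
      rw [← mul_assoc, p32, smul_mul_assoc, mul_assoc]
    have p32'' (z : T) : y 3 ^ l * (y 2 * z) =
        (q⁻¹ ^ 3) ^ (1 * l) • (y 2 * (y 3 ^ l * z)) := by
      simpa only [pow_one] using p32' 1 z
    simp only [sixMonomial, mul_add, mul_assoc, mul_smul_comm, smul_add,
      smul_smul, pow_zero, pow_one, one_mul, mul_one, h', p21', p32', p32'', pow_add _ k 2,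
      pow_add _ k 3, pow_add _ l 2, pow_succ _ k, pow_succ _ l, pow_succ _ (l - 1)]
    module
  rw [key]
  refine Submodule.add_mem _ (Submodule.add_mem _ (Submodule.add_mem _ (Submodule.add_mem _
    (Submodule.add_mem _ (Submodule.add_mem _ ?_ ?_) ?_) ?_) ?_) ?_) ?_
  · exact Submodule.smul_mem _ _ (sixMonomial_mem _ _ _ _ _ _ (by omega))
  -- For `l = 0` the exponent `l - 1 + 1` is 1 and the weight bound would fail; there the
  -- coefficient is zero.
  · rcases hc with rfl | hl
    · simp
    · exact Submodule.smul_mem _ _ (sixMonomial_mem _ _ _ _ _ _ (by omega))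
  all_goals exact Submodule.smul_mem _ _ (sixMonomial_mem _ _ _ _ _ _ (by omega))

/-- Centrality moves ω to just after the power of `E3`, reducing the claim to `inner_Omega1_mem`
between outer factors. -/
theorem Omega1_mul_sixMonomial (hy : Straightens (g2Coeff q) (g2Tail q) 6 y) {a a' : K} {ω : T}
    (hω : ω = y 0 * y 2 * y 4 + a • (y 0 * y 3) + a • (y 1 * y 4) + a' • y 2 ^ 2)
    (hc : ∀ x, Commute ω x) (i j k l m n : ℕ) :
    ω * sixMonomial y (i, j, k, l, m, n) - a' • sixMonomial y (i, j, k + 2, l, m, n) ∈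
      lowerSpan K y (3 * k + 5 * l + 6) := by
  have h := outer_mul_mem hy i j m n (hω ▸ inner_Omega1_mem hy a a' k l)
  convert h using 1
  calc _ = ω * (y 0 ^ i * y 1 ^ j * y 2 ^ k) * y 3 ^ l * (y 4 ^ m * y 5 ^ n) -
        a' • sixMonomial y (i, j, k + 2, l, m, n) := by simp only [sixMonomial, mul_assoc]
    _ = _ := by
      rw [(hc _).eq]
      simp only [sixMonomial, mul_sub, sub_mul, mul_smul_comm, smul_mul_assoc, mul_assoc]

theorem Omega2_mul_sixMonomial (hy : Straightens (g2Coeff q) (g2Tail q) 6 y) {b b' c' d' : K}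
    {ω : T} (hω : ω = y 1 * y 3 * y 5 + b • (y 1 * y 4 ^ 3) + b • (y 2 ^ 3 * y 5)
      + b' • (y 2 ^ 2 * y 4 ^ 2) + c' • (y 2 * y 3 * y 4) + d' • y 3 ^ 2)
    (hc : ∀ x, Commute ω x) (i j k l m n : ℕ) :
    ω * sixMonomial y (i, j, k, l, m, n) - d' • sixMonomial y (i, j, k, l + 2, m, n) ∈
      lowerSpan K y (3 * k + 5 * l + 10) := by
  have h := outer_mul_mem hy i j m n (hω ▸ inner_Omega2_mem hy b b' c' d' k l)
  convert h using 1
  calc _ = ω * (y 0 ^ i * y 1 ^ j * y 2 ^ k * y 3 ^ l) * (y 4 ^ m * y 5 ^ n) -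
        d' • sixMonomial y (i, j, k, l + 2, m, n) := by simp only [sixMonomial, mul_assoc]
    _ = _ := by
      rw [(hc _).eq]
      simp only [sixMonomial, mul_sub, sub_mul, mul_smul_comm, smul_mul_assoc, mul_assoc]

end Filtration

/-! ### Triangular change of basis and the adapted bases. -/

section Triangular

variable {K : Type u} [Field K] {T : Type u} [Ring T] [Algebra K T]

/-- A family which is triangular with respect to a basis, with invertible diagonal, is a basis. -/
theorem exists_basis_of_triangular {X : Type*} (B : Module.Basis X K T) (μ : X → ℕ) (F : X → T)
    (h : ∀ x, ∃ c : K, c ≠ 0 ∧ F x - c • B x ∈ Submodule.span K (B '' {z | μ z < μ x})) :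
    ∃ B' : Module.Basis X K T, ∀ x, B' x = F x := by
  choose c hc hF using h
  have coord_lower : ∀ x, ∀ v ∈ Submodule.span K (B '' {z | μ z < μ x}),
      ∀ w, μ x ≤ μ w → B.repr v w = 0 := by
    intro x v hv w hw
    have := B.repr_support_subset_of_mem_span _ hv
    by_contra hne
    exact absurd (this (Finsupp.mem_support_iff.mpr hne)) (not_lt.mpr hw)
  have hli : LinearIndependent K F := by
    rw [linearIndependent_iff]
    intro g hg
    by_contra hne
    -- For `x` of maximal weight in the support, no other `F w` with `w` in the support has a
    -- coordinate at `x`, so the relation forces `g x * c x = 0`.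
    obtain ⟨x, hx, hmax⟩ :=
      Finset.exists_max_image g.support μ (Finsupp.support_nonempty_iff.mpr hne)
    have h0 : B.repr (Finsupp.linearCombination K F g) x = 0 := by rw [hg]; simp
    rw [Finsupp.linearCombination_apply, Finsupp.sum, map_sum, Finsupp.finsetSum_apply,
      Finset.sum_eq_single x] at h0
    · have e := coord_lower x _ (hF x) x le_rfl
      simp only [map_sub, map_smul, Finsupp.sub_apply, Finsupp.smul_apply, Module.Basis.repr_self,
        Finsupp.single_eq_same, smul_eq_mul, mul_one, sub_eq_zero] at e
      simp only [map_smul, Finsupp.smul_apply, e, smul_eq_mul, mul_eq_zero, hc x, or_false] at h0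
      exact Finsupp.mem_support_iff.mp hx h0
    · intro w hw hwx
      have e := coord_lower w _ (hF w) x (hmax w hw)
      simp only [map_sub, map_smul, Finsupp.sub_apply, Finsupp.smul_apply, Module.Basis.repr_self,
        Finsupp.single_eq_of_ne hwx.symm, smul_zero, sub_zero] at e
      simp [e]
    · exact fun hx' => absurd hx hx'
  have hmem : ∀ N x, μ x < N → B x ∈ Submodule.span K (Set.range F) := by
    intro N
    induction N with
    | zero => exact fun x hx => absurd hx (Nat.not_lt_zero _)
    | succ N ih =>
      intro x hx
      have hlow : Submodule.span K (B '' {z | μ z < μ x}) ≤ Submodule.span K (Set.range F) :=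
        Submodule.span_le.mpr (by rintro _ ⟨z, hz, rfl⟩; exact ih z (lt_of_lt_of_le hz (by omega)))
      have e : B x = (c x)⁻¹ • (F x - (F x - c x • B x)) := by
        rw [sub_sub_cancel, smul_smul, inv_mul_cancel₀ (hc x), one_smul]
      rw [e]
      exact Submodule.smul_mem _ _ (Submodule.sub_mem _ (Submodule.subset_span ⟨x, rfl⟩)
        (hlow (hF x)))
  have hspan : ⊤ ≤ Submodule.span K (Set.range F) := by
    rw [← B.span_eq, Submodule.span_le]
    rintro _ ⟨x, rfl⟩
    exact hmem _ x (Nat.lt_succ_self _)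
  exact ⟨Module.Basis.mk hli hspan, fun x => by simp⟩

/-- `x` is a nonzero multiple of `u` up to monomials of weight less than `N`. -/
def LeadsTo (K : Type u) [Field K] [Algebra K T] (y : ℕ → T) (N : ℕ) (x u : T) : Prop :=
  ∃ c : K, c ≠ 0 ∧ x - c • u ∈ lowerSpan K y N

variable {y : ℕ → T}

/-- This carries the error terms along when ω is applied repeatedly in `LeadsTo.pow_mul`. -/
theorem mul_mem_lowerSpan {ω : T} {h : ℕ} {t : ℕ × ℕ × ℕ × ℕ × ℕ × ℕ → ℕ × ℕ × ℕ × ℕ × ℕ × ℕ}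
    (ht : ∀ s, weight (t s) = weight s + h)
    (hω : ∀ s, LeadsTo K y (weight s + h) (ω * sixMonomial y s) (sixMonomial y (t s)))
    {N : ℕ} {v : T} (hv : v ∈ lowerSpan K y N) : ω * v ∈ lowerSpan K y (N + h) := by
  induction hv using Submodule.span_induction with
  | mem x hx =>
    obtain ⟨s, hs, rfl⟩ := hx
    have hs' : weight s < N := hs
    obtain ⟨c, -, hc⟩ := hω s
    rw [← sub_add_cancel (ω * sixMonomial y s) (c • sixMonomial y (t s))]
    refine Submodule.add_mem _ (lowerSpan_mono (by omega) hc) (Submodule.smul_mem _ _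
      (Submodule.subset_span ⟨t s, ?_, rfl⟩))
    show weight (t s) < N + h
    rw [ht]; omega
  | zero => simp
  | add a b _ _ ha hb => rw [mul_add]; exact Submodule.add_mem _ ha hb
  | smul c a _ ha => rw [mul_smul_comm]; exact Submodule.smul_mem _ _ ha

theorem LeadsTo.pow_mul {ω : T} {h : ℕ}
    {t : ℕ × ℕ × ℕ × ℕ × ℕ × ℕ → ℕ × ℕ × ℕ × ℕ × ℕ × ℕ}
    (ht : ∀ s, weight (t s) = weight s + h)
    (hω : ∀ s, LeadsTo K y (weight s + h) (ω * sixMonomial y s) (sixMonomial y (t s)))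
    {x : T} {s : ℕ × ℕ × ℕ × ℕ × ℕ × ℕ} (hx : LeadsTo K y (weight s) x (sixMonomial y s)) (n : ℕ) :
    LeadsTo K y (weight (t^[n] s)) (ω ^ n * x) (sixMonomial y (t^[n] s)) := by
  induction n with
  | zero => simpa using hx
  | succ n ih =>
    obtain ⟨c, hc, hv⟩ := ih
    obtain ⟨c', hc', hv'⟩ := hω (t^[n] s)
    refine ⟨c * c', mul_ne_zero hc hc', ?_⟩
    rw [Function.iterate_succ_apply', ht]
    have e : ω ^ (n + 1) * x - (c * c') • sixMonomial y (t (t^[n] s)) =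
        ω * (ω ^ n * x - c • sixMonomial y (t^[n] s)) +
        c • (ω * sixMonomial y (t^[n] s) - c' • sixMonomial y (t (t^[n] s))) := by
      rw [pow_succ', mul_sub, smul_sub, smul_smul, mul_smul_comm, mul_assoc]
      abel
    rw [e]
    exact Submodule.add_mem _ (mul_mem_lowerSpan ht hω hv) (Submodule.smul_mem _ _ hv')

/-- Raising the exponent of the third generator by two. -/
def raiseThird : ℕ × ℕ × ℕ × ℕ × ℕ × ℕ → ℕ × ℕ × ℕ × ℕ × ℕ × ℕ
  | (i, j, k, l, m, n) => (i, j, k + 2, l, m, n)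

/-- Raising the exponent of the fourth generator by two. -/
def raiseFourth : ℕ × ℕ × ℕ × ℕ × ℕ × ℕ → ℕ × ℕ × ℕ × ℕ × ℕ × ℕ
  | (i, j, k, l, m, n) => (i, j, k, l + 2, m, n)

theorem iterate_raiseThird (i j k l m n r : ℕ) :
    raiseThird^[r] (i, j, k, l, m, n) = (i, j, k + 2 * r, l, m, n) := by
  induction r with
  | zero => rfl
  | succ r ih => rw [Function.iterate_succ_apply', ih]; rfl

theorem iterate_raiseFourth (i j k l m n r : ℕ) :
    raiseFourth^[r] (i, j, k, l, m, n) = (i, j, k, l + 2 * r, m, n) := by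
  induction r with
  | zero => rfl
  | succ r ih => rw [Function.iterate_succ_apply', ih]; rfl

/-- The basis elements of `U_q^+(G_2)` adapted to `ω₂`. -/
def fourthAdapted (y : ℕ → T) (ω₂ : T) : ℕ × ℕ × ℕ × ℕ × ℕ × ℕ → T
  | (i, j, k, l, m, n) => ω₂ ^ (l / 2) * sixMonomial y (i, j, k, l % 2, m, n)

/-- The basis elements of `U_q^+(G_2)` adapted to `ω₁` and `ω₂`. -/
def adapted (y : ℕ → T) (ω₁ ω₂ : T) : ℕ × ℕ × ℕ × ℕ × ℕ × ℕ → T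
  | (i, j, k, l, m, n) => ω₁ ^ (k / 2) * fourthAdapted y ω₂ (i, j, k % 2, l, m, n)

theorem leadsTo_sixMonomial (s : ℕ × ℕ × ℕ × ℕ × ℕ × ℕ) (N : ℕ) :
    LeadsTo K y N (sixMonomial y s) (sixMonomial y s) :=
  ⟨1, one_ne_zero, by simp⟩

theorem leadsTo_fourthAdapted {ω₂ : T}
    (h₂ : ∀ s, LeadsTo K y (weight s + 10) (ω₂ * sixMonomial y s) (sixMonomial y (raiseFourth s)))
    (s : ℕ × ℕ × ℕ × ℕ × ℕ × ℕ) :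
    LeadsTo K y (weight s) (fourthAdapted y ω₂ s) (sixMonomial y s) := by
  obtain ⟨i, j, k, l, m, n⟩ := s
  have := LeadsTo.pow_mul (fun s => by simp only [weight, raiseFourth]; ring) h₂
    (leadsTo_sixMonomial (i, j, k, l % 2, m, n) _) (l / 2)
  rwa [iterate_raiseFourth, Nat.mod_add_div] at this

theorem leadsTo_adapted {ω₁ ω₂ : T}
    (h₁ : ∀ s, LeadsTo K y (weight s + 6) (ω₁ * sixMonomial y s) (sixMonomial y (raiseThird s)))
    (h₂ : ∀ s, LeadsTo K y (weight s + 10) (ω₂ * sixMonomial y s) (sixMonomial y (raiseFourth s)))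
    (s : ℕ × ℕ × ℕ × ℕ × ℕ × ℕ) :
    LeadsTo K y (weight s) (adapted y ω₁ ω₂ s) (sixMonomial y s) := by
  obtain ⟨i, j, k, l, m, n⟩ := s
  have := LeadsTo.pow_mul (fun s => by simp only [weight, raiseThird]; ring) h₁
    (leadsTo_fourthAdapted h₂ (i, j, k % 2, l, m, n)) (k / 2)
  rwa [iterate_raiseThird, Nat.mod_add_div] at this

/-- In the adapted bases multiplication by the central elements is an exact shift of indices, with
no lower terms; this makes the quotients computable. -/
theorem mul_fourthAdapted (y : ℕ → T) (ω₂ : T) (s : ℕ × ℕ × ℕ × ℕ × ℕ × ℕ) :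
    ω₂ * fourthAdapted y ω₂ s = fourthAdapted y ω₂ (raiseFourth s) := by
  obtain ⟨i, j, k, l, m, n⟩ := s
  simp only [fourthAdapted, raiseFourth, Nat.add_div_right l two_pos, Nat.add_mod_right]
  rw [pow_succ', mul_assoc]

theorem mul_adapted_third (y : ℕ → T) (ω₁ ω₂ : T) (s : ℕ × ℕ × ℕ × ℕ × ℕ × ℕ) :
    ω₁ * adapted y ω₁ ω₂ s = adapted y ω₁ ω₂ (raiseThird s) := by
  obtain ⟨i, j, k, l, m, n⟩ := s
  simp only [adapted, raiseThird, Nat.add_div_right k two_pos, Nat.add_mod_right]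
  rw [pow_succ', mul_assoc]

theorem mul_adapted_fourth (y : ℕ → T) {ω₁ ω₂ : T} (h : Commute ω₂ ω₁)
    (s : ℕ × ℕ × ℕ × ℕ × ℕ × ℕ) :
    ω₂ * adapted y ω₁ ω₂ s = adapted y ω₁ ω₂ (raiseFourth s) := by
  obtain ⟨i, j, k, l, m, n⟩ := s
  simp only [adapted, raiseFourth]
  rw [← mul_assoc, (h.pow_right _).eq, mul_assoc, mul_fourthAdapted]
  rfl

end Triangular

/-! ### Quotients by central elements. -/

section Quotient

variable {K : Type u} [Field K] {A : Type u} [Ring A] [Algebra K A]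

/-- The elements x with π(a x b) = 0 for all a, b form a two-sided ideal; it contains `Z` because a
z b = z a b for central z. -/
theorem mul_eq_zero_of_mem_span {W : Type*} [AddCommGroup W] [Module K W] (π : A →ₗ[K] W)
    {Z : Set A} (hc : ∀ z ∈ Z, ∀ a, Commute z a) (hπ : ∀ z ∈ Z, ∀ a, π (z * a) = 0) {x : A}
    (hx : x ∈ TwoSidedIdeal.span Z) : π x = 0 := by
  let J : TwoSidedIdeal A := .mk' {x | ∀ a b, π (a * x * b) = 0} (by simp)
    (fun {x z} hx hz a b => by rw [mul_add, add_mul, map_add, hx a b, hz a b, add_zero])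
    (fun {x} hx a b => by rw [mul_neg, neg_mul, map_neg, hx a b, neg_zero])
    (fun {x z} hz a b => by rw [← mul_assoc]; exact hz (a * x) b)
    (fun {x z} hx a b => by rw [← mul_assoc, mul_assoc]; exact hx a (z * b))
  have hJ : TwoSidedIdeal.span Z ≤ J := TwoSidedIdeal.span_le.mpr fun z hz =>
    (TwoSidedIdeal.mem_mk' _ _ _ _ _ _ _).mpr fun a b => by
      rw [← (hc z hz a).eq, mul_assoc]; exact hπ z hz _
  have := (TwoSidedIdeal.mem_mk' _ _ _ _ _ _ _).mp (hJ hx) 1 1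
  simpa using this

/-- A basis of the quotient of an algebra by central elements, from a basis which is stable under
multiplication by them in a suitable sense. -/
theorem exists_basis_quotient_of_central {X Y : Type*} (B : Module.Basis X K A) {Z : Set A}
    (hZ : ∀ z ∈ Z, ∀ a, Commute z a) (φ : X → K) (r : X → Y) (ι : Y → X)
    (hφ : ∀ y, φ (ι y) = 1) (hr : ∀ y, r (ι y) = y)
    (hmk : ∀ x, (TwoSidedIdeal.span Z).ringCon.mk' (B x) =
      φ x • (TwoSidedIdeal.span Z).ringCon.mk' (B (ι (r x))))
    (hπ : ∀ z ∈ Z, ∀ x,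
      B.constr K (fun x => φ x • (Finsupp.single (r x) 1 : Y →₀ K)) (z * B x) = 0) :
    ∃ B' : Module.Basis Y K (TwoSidedIdeal.span Z).ringCon.Quotient,
      ∀ y, B' y = (TwoSidedIdeal.span Z).ringCon.mk' (B (ι y)) := by
  set I := TwoSidedIdeal.span Z with hI
  let p : A →ₐ[K] I.ringCon.Quotient := I.ringCon.mkₐ (α := K)
  -- `π` is the candidate coordinate map of the quotient: `B x` reduces to `φ x` times the basis
  -- vector indexed by `r x`. It kills the ideal and sends the chosen representatives to the
  -- standard basis, whence independence.
  set π := B.constr K (fun x => φ x • (Finsupp.single (r x) 1 : Y →₀ K)) with hπdef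
  have hπι : ∀ y, π (B (ι y)) = Finsupp.single y 1 := fun y => by
    rw [hπdef, Module.Basis.constr_basis, hφ, hr, one_smul]
  have hπ0 : ∀ x ∈ I, π x = 0 := fun x hx =>
    mul_eq_zero_of_mem_span π hZ (fun z hz a => by
      have : π ∘ₗ LinearMap.mulLeft K z = 0 := B.ext fun x => hπ z hz x
      exact LinearMap.congr_fun this a) hx
  have hli : LinearIndependent K fun y => p (B (ι y)) := by
    rw [linearIndependent_iff]
    intro g hg
    have e : p (Finsupp.linearCombination K (fun y => B (ι y)) g) = 0 := by
      rw [← hg]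
      simp [Finsupp.linearCombination_apply, Finsupp.sum, map_sum, map_smul]
    have hmem : Finsupp.linearCombination K (fun y => B (ι y)) g ∈ I := by
      rw [TwoSidedIdeal.mem_iff]
      exact (RingCon.eq _).mp e
    have h0 := hπ0 _ hmem
    rw [Finsupp.linearCombination_apply, map_finsuppSum] at h0
    simpa only [map_smul, hπι, Finsupp.smul_single, smul_eq_mul, mul_one,
      Finsupp.sum_single] using h0
  have hspan : ⊤ ≤ Submodule.span K (Set.range fun y => p (B (ι y))) := by
    rintro z -
    obtain ⟨x, rfl⟩ := I.ringCon.mkₐ_surjective (α := K) z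
    have hx : x ∈ Submodule.span K (Set.range B) := B.mem_span x
    induction hx using Submodule.span_induction with
    | mem _ h =>
      obtain ⟨x, rfl⟩ := h
      have e : p (B x) = φ x • p (B (ι (r x))) := hmk x
      show p (B x) ∈ _
      rw [e]
      exact Submodule.smul_mem _ _ (Submodule.subset_span ⟨r x, rfl⟩)
    | zero => rw [map_zero]; exact Submodule.zero_mem _
    | add a b _ _ ha hb => rw [map_add]; exact Submodule.add_mem _ ha hb
    | smul c a _ ha => rw [map_smul]; exact Submodule.smul_mem _ _ ha
  exact ⟨Module.Basis.mk hli hspan, fun y => by rw [Module.Basis.mk_apply]; rfl⟩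

end Quotient

/-! ### The two quotients in terms of the adapted bases. -/

section AdaptedQuotients

variable {K : Type u} [Field K] {T : Type u} [Ring T] [Algebra K T] {y : ℕ → T}

theorem mk'_eq_algebraMap {Z : Set T} {ω : T} {β : K} (h : ω - algebraMap K T β ∈ Z) :
    (TwoSidedIdeal.span Z).ringCon.mk' ω = algebraMap K _ β :=
  (RingCon.eq _).mpr ((TwoSidedIdeal.rel_iff _ _ _).mpr (TwoSidedIdeal.subset_span h))

theorem mk'_pow_mul {Z : Set T} {ω : T} {β : K} (h : ω - algebraMap K T β ∈ Z) (n : ℕ) (x : T) :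
    (TwoSidedIdeal.span Z).ringCon.mk' (ω ^ n * x) =
      β ^ n • (TwoSidedIdeal.span Z).ringCon.mk' x := by
  rw [map_mul, map_pow, mk'_eq_algebraMap h, ← map_pow, ← Algebra.smul_def]

theorem commute_sub_algebraMap {ω : T} (h : ∀ x, Commute ω x) (β : K) (x : T) :
    Commute (ω - algebraMap K T β) x :=
  (h x).sub_left (Algebra.commute_algebraMap_left β x)

theorem exists_basis_quotient_fourthAdapted {ω₂ : T}
    (B : Module.Basis (ℕ × ℕ × ℕ × ℕ × ℕ × ℕ) K T) (hB : ∀ s, B s = sixMonomial y s)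
    (hc₂ : ∀ x, Commute ω₂ x)
    (h₂ : ∀ s, LeadsTo K y (weight s + 10) (ω₂ * sixMonomial y s) (sixMonomial y (raiseFourth s)))
    (β : K) :
    ∃ B' : Module.Basis (ℕ × ℕ × ℕ × Fin 2 × ℕ × ℕ) K
        (TwoSidedIdeal.span {ω₂ - algebraMap K T β}).ringCon.Quotient,
      ∀ (i j k : ℕ) (ξ : Fin 2) (l m : ℕ), B' (i, j, k, ξ, l, m) =
        (TwoSidedIdeal.span {ω₂ - algebraMap K T β}).ringCon.mk'
          (sixMonomial y (i, j, k, ξ, l, m)) := by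
  have hrange : ∀ N, lowerSpan K y N = Submodule.span K (B '' {s | weight s < N}) := fun N => by
    rw [lowerSpan, funext hB]
  obtain ⟨F, hF⟩ := exists_basis_of_triangular B weight (fourthAdapted y ω₂) fun s => by
    simpa only [LeadsTo, hrange, hB] using leadsTo_fourthAdapted h₂ s
  -- The `l / 2` factors ω₂ become powers of β, and `r` keeps the parity of the exponent of `E4`.
  let φ : ℕ × ℕ × ℕ × ℕ × ℕ × ℕ → K := fun (_, _, _, l, _, _) => β ^ (l / 2)
  let r : ℕ × ℕ × ℕ × ℕ × ℕ × ℕ → ℕ × ℕ × ℕ × Fin 2 × ℕ × ℕ :=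
    fun (i, j, k, l, m, n) => (i, j, k, Fin.ofNat 2 l, m, n)
  let ι : ℕ × ℕ × ℕ × Fin 2 × ℕ × ℕ → ℕ × ℕ × ℕ × ℕ × ℕ × ℕ :=
    fun (i, j, k, ξ, m, n) => (i, j, k, ξ, m, n)
  have hι : ∀ t, F (ι t) = sixMonomial y (ι t) := by
    rintro ⟨i, j, k, ξ, l, m⟩
    simp only [hF, ι, fourthAdapted, Nat.div_eq_of_lt ξ.2, Nat.mod_eq_of_lt ξ.2, pow_zero, one_mul]
  obtain ⟨B', hB'⟩ := exists_basis_quotient_of_central F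
    (Z := {ω₂ - algebraMap K T β}) (by
      rintro _ rfl
      exact commute_sub_algebraMap hc₂ β) φ r ι
    (by
      rintro ⟨i, j, k, ξ, l, m⟩
      simp only [φ, ι, Nat.div_eq_of_lt ξ.2, pow_zero])
    (by
      rintro ⟨i, j, k, ξ, l, m⟩
      simp [r, ι])
    (by
      rintro ⟨i, j, k, l, m, n⟩
      have e := hι (r (i, j, k, l, m, n))
      rw [e, hF]
      exact mk'_pow_mul (Set.mem_singleton (ω₂ - algebraMap K T β)) _ _)
    (by
      rintro _ rfl ⟨i, j, k, l, m, n⟩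
      rw [sub_mul, ← Algebra.smul_def, hF, mul_fourthAdapted, ← hF, ← hF, map_sub, map_smul,
        Module.Basis.constr_basis, Module.Basis.constr_basis, sub_eq_zero, smul_smul]
      simp only [φ, r, raiseFourth, Nat.add_div_right l two_pos, pow_succ']
      congr 4
      simp [Fin.ext_iff])
  exact ⟨B', fun i j k ξ l m =>
    (hB' _).trans (congrArg _ (hι (i, j, k, ξ, l, m)))⟩

theorem exists_basis_quotient_adapted {ω₁ ω₂ : T}
    (B : Module.Basis (ℕ × ℕ × ℕ × ℕ × ℕ × ℕ) K T) (hB : ∀ s, B s = sixMonomial y s)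
    (hc₁ : ∀ x, Commute ω₁ x) (hc₂ : ∀ x, Commute ω₂ x)
    (h₁ : ∀ s, LeadsTo K y (weight s + 6) (ω₁ * sixMonomial y s) (sixMonomial y (raiseThird s)))
    (h₂ : ∀ s, LeadsTo K y (weight s + 10) (ω₂ * sixMonomial y s) (sixMonomial y (raiseFourth s)))
    (α β : K) :
    ∃ B' : Module.Basis (ℕ × ℕ × Fin 2 × Fin 2 × ℕ × ℕ) K
        (TwoSidedIdeal.span {ω₁ - algebraMap K T α, ω₂ - algebraMap K T β}).ringCon.Quotient,
      ∀ (i j : ℕ) (ε₁ ε₂ : Fin 2) (k l : ℕ), B' (i, j, ε₁, ε₂, k, l) =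
        (TwoSidedIdeal.span {ω₁ - algebraMap K T α, ω₂ - algebraMap K T β}).ringCon.mk'
          (sixMonomial y (i, j, ε₁, ε₂, k, l)) := by
  have hrange : ∀ N, lowerSpan K y N = Submodule.span K (B '' {s | weight s < N}) := fun N => by
    rw [lowerSpan, funext hB]
  obtain ⟨F, hF⟩ := exists_basis_of_triangular B weight (adapted y ω₁ ω₂) fun s => by
    simpa only [LeadsTo, hrange, hB] using leadsTo_adapted h₁ h₂ s
  let φ : ℕ × ℕ × ℕ × ℕ × ℕ × ℕ → K := fun (_, _, k, l, _, _) => α ^ (k / 2) * β ^ (l / 2)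
  let r : ℕ × ℕ × ℕ × ℕ × ℕ × ℕ → ℕ × ℕ × Fin 2 × Fin 2 × ℕ × ℕ :=
    fun (i, j, k, l, m, n) => (i, j, Fin.ofNat 2 k, Fin.ofNat 2 l, m, n)
  let ι : ℕ × ℕ × Fin 2 × Fin 2 × ℕ × ℕ → ℕ × ℕ × ℕ × ℕ × ℕ × ℕ :=
    fun (i, j, ε₁, ε₂, m, n) => (i, j, ε₁, ε₂, m, n)
  have hι : ∀ t, F (ι t) = sixMonomial y (ι t) := by
    rintro ⟨i, j, ε₁, ε₂, l, m⟩
    simp only [hF, ι, adapted, fourthAdapted, Nat.div_eq_of_lt ε₁.2, Nat.mod_eq_of_lt ε₁.2,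
      Nat.div_eq_of_lt ε₂.2, Nat.mod_eq_of_lt ε₂.2, pow_zero, one_mul]
  obtain ⟨B', hB'⟩ := exists_basis_quotient_of_central F
    (Z := {ω₁ - algebraMap K T α, ω₂ - algebraMap K T β}) (by
      rintro _ (rfl | rfl)
      · exact commute_sub_algebraMap hc₁ α
      · exact commute_sub_algebraMap hc₂ β) φ r ι
    (by
      rintro ⟨i, j, ε₁, ε₂, l, m⟩
      simp only [φ, ι, Nat.div_eq_of_lt ε₁.2, Nat.div_eq_of_lt ε₂.2, pow_zero, mul_one])
    (by
      rintro ⟨i, j, ε₁, ε₂, l, m⟩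
      simp [r, ι])
    (by
      rintro ⟨i, j, k, l, m, n⟩
      have e := hι (r (i, j, k, l, m, n))
      rw [e, hF, adapted, mk'_pow_mul (Set.mem_insert (ω₁ - algebraMap K T α) _),
        fourthAdapted,
        mk'_pow_mul (Set.mem_insert_of_mem _ (Set.mem_singleton (ω₂ - algebraMap K T β))),
        smul_smul]
      rfl)
    (by
      rintro _ (rfl | rfl) ⟨i, j, k, l, m, n⟩
      · rw [sub_mul, ← Algebra.smul_def, hF, mul_adapted_third, ← hF, ← hF, map_sub, map_smul,
          Module.Basis.constr_basis, Module.Basis.constr_basis, sub_eq_zero, smul_smul]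
        simp only [φ, r, raiseThird, Nat.add_div_right k two_pos, pow_succ', mul_assoc]
        congr 4
        simp [Fin.ext_iff]
      · rw [sub_mul, ← Algebra.smul_def, hF, mul_adapted_fourth y (hc₂ ω₁), ← hF, ← hF, map_sub,
          map_smul, Module.Basis.constr_basis, Module.Basis.constr_basis, sub_eq_zero, smul_smul]
        simp only [φ, r, raiseFourth, Nat.add_div_right l two_pos, pow_succ', mul_left_comm β]
        congr 5
        simp [Fin.ext_iff])
  exact ⟨B', fun i j ε₁ ε₂ k l =>
    (hB' _).trans (congrArg _ (hι (i, j, ε₁, ε₂, k, l)))⟩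

end AdaptedQuotients

end QuantumG2

open QuantumG2 QuantumG2.Gen in
theorem mainTheorem7 {K : Type*} [Field K] (q : K) (hq0 : q ≠ 0)
    (hq : ∀ n : ℕ, 0 < n → q ^ n ≠ 1) :
    (∀ α β : K, (α, β) ≠ (0, 0) →
      ∃ B : Module.Basis (ℕ × ℕ × Fin 2 × Fin 2 × ℕ × ℕ) K (AAB q α β),
        ∀ (i j : ℕ) (ε₁ ε₂ : Fin 2) (k l : ℕ),
          B (i, j, ε₁, ε₂, k, l) =
            e q α β E1 ^ i * e q α β E2 ^ j * e q α β E3 ^ (ε₁ : ℕ) *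
              e q α β E4 ^ (ε₂ : ℕ) * e q α β E5 ^ k * e q α β E6 ^ l) ∧
    (∀ β : K,
      ∃ B : Module.Basis (ℕ × ℕ × ℕ × Fin 2 × ℕ × ℕ) K (AB q β),
        ∀ (i j k : ℕ) (ξ : Fin 2) (l m : ℕ),
          B (i, j, k, ξ, l, m) =
            eB q β E1 ^ i * eB q β E2 ^ j * eB q β E3 ^ k *
              eB q β E4 ^ (ξ : ℕ) * eB q β E5 ^ l * eB q β E6 ^ m) := by
  have hq2 : q ^ 2 - 1 ≠ 0 := sub_ne_zero.mpr (hq 2 (by norm_num))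
  have hq6 : q ^ 6 - 1 ≠ 0 := sub_ne_zero.mpr (hq 6 (by norm_num))
  -- q⁶ - 1 = (q² - 1)(q⁴ + q² + 1).
  have hD : q ^ 2 * (q ^ 2 + 1) + 1 ≠ 0 := fun h => hq6 (by linear_combination (q ^ 2 - 1) * h)
  obtain ⟨B, hB⟩ := exists_basis_sixMonomial hq0 hD
  have hc₁ := commute_Omega1 hq0 hD hq2
  have hc₂ := commute_Omega2 hq0 hD hq2
  have h₁ : ∀ s, LeadsTo K (rootVec q) (weight s + 6) (Omega1 q * sixMonomial (rootVec q) s)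
      (sixMonomial (rootVec q) (raiseThird s)) := fun (i, j, k, l, m, n) =>
    -- The leading coefficient a' is nonzero as q ≠ 0; its denominator is nonzero as q² ≠ 1.
    ⟨cA' q, div_ne_zero (pow_ne_zero 6 hq0) hq2,
      Omega1_mul_sixMonomial straightens_rootVec rfl hc₁ i j k l m n⟩
  have h₂ : ∀ s, LeadsTo K (rootVec q) (weight s + 10) (Omega2 q * sixMonomial (rootVec q) s)
      (sixMonomial (rootVec q) (raiseFourth s)) := fun (i, j, k, l, m, n) =>
    ⟨cD' q, div_ne_zero (pow_ne_zero 12 hq0) hq6,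
      Omega2_mul_sixMonomial straightens_rootVec rfl hc₂ i j k l m n⟩
  refine ⟨fun α β _ => ?_, fun β => ?_⟩
  · obtain ⟨B', hB'⟩ := exists_basis_quotient_adapted B hB hc₁ hc₂ h₁ h₂ α β
    refine ⟨B', fun i j ε₁ ε₂ k l => (hB' i j ε₁ ε₂ k l).trans ?_⟩
    simp only [sixMonomial, map_mul, map_pow]
    rfl
  · obtain ⟨B', hB'⟩ := exists_basis_quotient_fourthAdapted B hB hc₂ h₂ β
    refine ⟨B', fun i j k ξ l m => (hB' i j k ξ l m).trans ?_⟩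
    simp only [sixMonomial, map_mul, map_pow]
    rfl
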